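/- A college admission market consists of a finite set $C$ of $m$ colleges and a finite set $S$ of $n$ students; every college $c$ has a capacity $q(c)\ge 1$ and a strict complete preference list $>_c$ over all students, and every student has a strict complete preference list over all colleges. The outcome $\mu$ of college-proposing deferred acceptance is computed in rounds: each college $c$ first makes offers to its $q(c)$ favourite students; each student keeps the favourite of all offers received so far and rejects the others; each college just rejected by $k$ students makes offers to its $k$ favourites among the students to whom it has made no offer yet (to all of them if there are fewer than $k$), and so on until no further offer is made. Preferences of $c$ over sets of at most $q(c)$ students are responsive: "better" is the transitive closure of $S'\cup\{s\}>_cS'\cup\{s'\}$ whenever $s>_cs'$, and $S'\cup\{s\}>_cS'$, where $|S'|<q(c)$ and $s,s'\in S\setminus S'$; sets not related in this way are incomparable. A college $c$ may report any complete preference list while all other agents are truthful and the capacities are fixed. A report is an optimal manipulation if the set of students it yields for $c$ under college-proposing deferred acceptance is equal to or better than the set $\mu(c)$ obtained by truthful reporting, and no report of $c$ yields a set better still. Finding an optimal manipulation is fixed-parameter tractable with respect to the parameter $q(c)$: there is a single algorithm (a program of a random access machine with addition and subtraction at unit cost) and a polynomial $P$ such that, for every market and every college $c$, the algorithm, given the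 market and $c$, outputs an optimal manipulation of $c$ after at most $2^{q(c)-1}\cdot P(m+n)$ steps. -/

import Mathlib

/-- A college admission market with `m` colleges and `n` students. A strict complete preference
relation is given by its list, a bijection from positions to agents (position `0` is the most
preferred agent). Every college has a capacity of at least one. -/
structure Market (m n : ℕ) where
  q : Fin m → ℕ
  one_le_q : ∀ c, 1 ≤ q c
  collegeList : Fin m → Equiv.Perm (Fin n)
  studentList : Fin n → Equiv.Perm (Fin m)

/-- `Prefers l a b`: the agent with preference list `l` strictly prefers `a` to `b`. -/
abbrev Prefers {k : ℕ} (l : Equiv.Perm (Fin k)) (a b : Fin k) : Prop :=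
  l.symm a < l.symm b

/-- The `k` most preferred elements of `X` (all of `X` if it has fewer than `k` elements). -/
def favourites {n : ℕ} (l : Equiv.Perm (Fin n)) (k : ℕ) (X : Finset (Fin n)) : Finset (Fin n) :=
  X.filter fun s => (X.filter fun t => Prefers l t s).card < k

/-- The basic comparisons of responsive preferences of a college with capacity `q` and preference
list `l`: `ResponsiveStep l q X Y` means that `X` is better than `Y`, either because one student
is replaced by a preferred one, or because a student is added to a set that is not full. -/
inductive ResponsiveStep {n : ℕ} (l : Equiv.Perm (Fin n)) (q : ℕ) :
    Finset (Fin n) → Finset (Fin n) → Prop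
  | replace (X : Finset (Fin n)) (s s' : Fin n) (hX : X.card < q) (hs : s ∉ X) (hs' : s' ∉ X)
      (h : Prefers l s s') : ResponsiveStep l q (insert s X) (insert s' X)
  | add (X : Finset (Fin n)) (s : Fin n) (hX : X.card < q) (hs : s ∉ X) :
      ResponsiveStep l q (insert s X) X

/-- `X` is strictly better than `Y` with respect to the responsive relation. Sets that are not
compared by this relation are incomparable. -/
def ResponsivelyBetter {n : ℕ} (l : Equiv.Perm (Fin n)) (q : ℕ) (X Y : Finset (Fin n)) : Prop :=
  Relation.TransGen (ResponsiveStep l q) X Y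

namespace Market

variable {m n : ℕ}

/-- The state of college-proposing deferred acceptance between two rounds: the students to whom
each college has made an offer so far, and those among them who have rejected it so far. -/
structure DAState (m n : ℕ) where
  offers : Fin m → Finset (Fin n)
  rejected : Fin m → Finset (Fin n)

/-- Among the colleges that made an offer to `s` so far, `c` is the favourite of `s`. -/
abbrev Keeps (M : Market m n) (offers : Fin m → Finset (Fin n)) (s : Fin n) (c : Fin m) : Prop :=
  s ∈ offers c ∧ ∀ c', s ∈ offers c' → c' = c ∨ Prefers (M.studentList s) c c'

/-- Each college makes offers to its `q` favourite students. -/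
def daStart (M : Market m n) : DAState m n where
  offers c := favourites (M.collegeList c) (M.q c) Finset.univ
  rejected _ := ∅

/-- The students who reject `c`, given all offers made so far. -/
def rejecters (M : Market m n) (offers : Fin m → Finset (Fin n)) (c : Fin m) : Finset (Fin n) :=
  (offers c).filter fun s => ¬ M.Keeps offers s c

/-- One round: every student keeps the favourite offer and rejects all others, and every college
that has just been rejected by `k` students makes offers to its `k` favourites among the students
to whom it has not yet made an offer. -/
def daRound (M : Market m n) (σ : DAState m n) : DAState m n where
  offers c := σ.offers c ∪
    favourites (M.collegeList c) (M.rejecters σ.offers c \ σ.rejected c).card (σ.offers c)ᶜ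
  rejected c := M.rejecters σ.offers c

/-- The outcome of college-proposing deferred acceptance: the set of students matched with each
college. Every round before the procedure stops makes at least one of the `m * n` possible offers,
and later rounds change nothing, so `m * n` rounds are always enough. -/
def collegeProposingDA (M : Market m n) (c : Fin m) : Finset (Fin n) :=
  let final := M.daRound^[m * n] M.daStart
  (final.offers c).filter fun s => M.Keeps final.offers s c

/-- The market in which `c` reports the complete list `p` and all others report truthfully. -/
def misreport (M : Market m n) (c : Fin m) (p : Equiv.Perm (Fin n)) : Market m n where
  q := M.q
  one_le_q := M.one_le_q
  collegeList := Function.update M.collegeList c p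
  studentList := M.studentList

/-- What `c` obtains under college-proposing deferred acceptance by reporting `p`. -/
def outcomeOfReport (M : Market m n) (c : Fin m) (p : Equiv.Perm (Fin n)) : Finset (Fin n) :=
  (M.misreport c p).collegeProposingDA c

/-- `p` is an optimal report of `c`: its outcome is the truthful one or better than it, and no
report has an outcome that is better still. "Better" refers to the true preferences of `c`. -/
def IsOptimalManipulation (M : Market m n) (c : Fin m) (p : Equiv.Perm (Fin n)) : Prop :=
  (M.outcomeOfReport c p = M.collegeProposingDA c ∨
    ResponsivelyBetter (M.collegeList c) (M.q c)
      (M.outcomeOfReport c p) (M.collegeProposingDA c)) ∧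
  ∀ p' : Equiv.Perm (Fin n),
    ¬ ResponsivelyBetter (M.collegeList c) (M.q c) (M.outcomeOfReport c p') (M.outcomeOfReport c p)

end Market

namespace RAM

/-- Configurations of a random access machine: registers and memory cells hold natural numbers. -/
structure State where
  reg : ℕ → ℕ
  mem : ℕ → ℕ

/-- Store `v` in register `x`. -/
def State.setReg (σ : State) (x v : ℕ) : State :=
  { σ with reg := Function.update σ.reg x v }

/-- Store `v` in the memory cell `a`. -/
def State.setMem (σ : State) (a v : ℕ) : State :=
  { σ with mem := Function.update σ.mem a v }

/-- Structured programs of a random access machine with addition and (truncated) subtraction. The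
arguments are names of registers, except that the second argument of `const` is a number. -/
inductive Cmd : Type
  | skip
  | const (x k : ℕ)
  | copy (x y : ℕ)
  | add (x y z : ℕ)
  | sub (x y z : ℕ)
  | load (x y : ℕ)
  | store (x y : ℕ)
  | seq (c d : Cmd)
  | ite (x : ℕ) (c d : Cmd)
  | loop (x : ℕ) (c : Cmd)

/-- `Exec c σ τ t`: started in `σ`, the program `c` halts in `τ` after exactly `t` steps. Every
elementary instruction and every test of a register takes one step. -/
inductive Exec : Cmd → State → State → ℕ → Prop
  | skip (σ : State) : Exec .skip σ σ 1
  | const (σ : State) (x k : ℕ) : Exec (.const x k) σ (σ.setReg x k) 1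
  | copy (σ : State) (x y : ℕ) : Exec (.copy x y) σ (σ.setReg x (σ.reg y)) 1
  | add (σ : State) (x y z : ℕ) : Exec (.add x y z) σ (σ.setReg x (σ.reg y + σ.reg z)) 1
  | sub (σ : State) (x y z : ℕ) : Exec (.sub x y z) σ (σ.setReg x (σ.reg y - σ.reg z)) 1
  | load (σ : State) (x y : ℕ) : Exec (.load x y) σ (σ.setReg x (σ.mem (σ.reg y))) 1
  | store (σ : State) (x y : ℕ) : Exec (.store x y) σ (σ.setMem (σ.reg x) (σ.reg y)) 1
  | seq {c d : Cmd} {σ τ ρ : State} {t u : ℕ} (h₁ : Exec c σ τ t) (h₂ : Exec d τ ρ u) :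
      Exec (.seq c d) σ ρ (t + u)
  | ite_true {x : ℕ} {c d : Cmd} {σ τ : State} {t : ℕ} (hx : σ.reg x ≠ 0) (h : Exec c σ τ t) :
      Exec (.ite x c d) σ τ (t + 1)
  | ite_false {x : ℕ} {c d : Cmd} {σ τ : State} {t : ℕ} (hx : σ.reg x = 0) (h : Exec d σ τ t) :
      Exec (.ite x c d) σ τ (t + 1)
  | loop_stop {x : ℕ} {c : Cmd} {σ : State} (hx : σ.reg x = 0) : Exec (.loop x c) σ σ 1
  | loop_step {x : ℕ} {c : Cmd} {σ τ ρ : State} {t u : ℕ} (hx : σ.reg x ≠ 0)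
      (h₁ : Exec c σ τ t) (h₂ : Exec (.loop x c) τ ρ u) : Exec (.loop x c) σ ρ (t + u + 1)

end RAM

/-- The instance as a list of numbers: the number of colleges, the number of students, the
manipulating college, all capacities, then the preference lists of the colleges and those of the
students, each with the most preferred agent first. -/
def Market.encode {m n : ℕ} (M : Market m n) (c : Fin m) : List ℕ :=
  [m, n, (c : ℕ)] ++ List.ofFn M.q ++
    (List.ofFn fun j => List.ofFn fun k => ((M.collegeList j k : Fin n) : ℕ)).flatten ++
    (List.ofFn fun s => List.ofFn fun k => ((M.studentList s k : Fin m) : ℕ)).flatten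

/-- The input configuration: the instance in the first memory cells, zero everywhere else. -/
def Market.inputState {m n : ℕ} (M : Market m n) (c : Fin m) : RAM.State where
  reg _ := 0
  mem a := (M.encode c).getD a 0

/-- The first `n` memory cells hold the preference list `p`, most preferred student first. -/
def RAM.State.HoldsList {n : ℕ} (σ : RAM.State) (p : Equiv.Perm (Fin n)) : Prop :=
  ∀ k : Fin n, σ.mem (k : ℕ) = ((p k : Fin n) : ℕ)

/-! ### Least fixed points of monotone maps on families of finite sets -/

section Iterate

variable {m n : ℕ} {f : (Fin m → Finset (Fin n)) → Fin m → Finset (Fin n)}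

/-! The exponential factor is not needed: greedy deletion finds an optimal manipulation in
polynomial time.

Deferred acceptance iterates a monotone operator on families of offers, so its offers form a least
fixed point (`daRound_iterate`, `finalOffers_le`). Let `c` make offers exactly to `Y` while the
other colleges proceed as usual; `chosen c Y` is the part of `Y` that stays with `c`. This choice
function is substitutable (`mem_chosen_of_subset`) and obeys the law of aggregate demand
(`card_chosen_mono`).

If `chosen c univ` has fewer than `q c` elements, it is the outcome of every report
(`outcomeOfReport_of_card_lt`). Otherwise the outcomes of reports are precisely the sets `T` of `q
c` students with `chosen c T = T`: each such `T` is obtained by listing it first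
(`outcomeOfReport_of_topStudents`).

In this second case, start with all students and go through them from the least preferred one
upwards, deleting a student whenever `c` can still fill its capacity from the rest. The survivors
form such a set (`survivors_spec`). No such set `T` is better (`not_responsivelyBetter_survivors`):
look at the least preferred student `s` on which the two sets differ. If `s` lies in `T`, then `T`
has too few students preferred to `s`, since better sets have at least as many elements in every
initial segment. If `s` survives, then all of `T` was still available when `s` was tested, so by
aggregate demand `s` would have been deleted. The survivors are also at least as good as the
truthful outcome (`survivors_inter_reportOffers`): inside the set of truthful offers, each deletion
leaves the chosen set as it is or replaces one student by a preferred one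
(`AtLeastTruthful.chosen_erase`).

The greedy procedure is written in a small language of bounded loops. Its compilation to machine
code is correct and runs in polynomial time (`RAM.Stmt.exec_compile`, `RAM.Stmt.polyBounded_cost`),
and `run_mainS` identifies the result. -/

theorem iterate_bot_le (hf : Monotone f) {P : Fin m → Finset (Fin n)} (hP : f P ≤ P) (k : ℕ) :
    f^[k] ⊥ ≤ P := by
  induction k with
  | zero => exact bot_le
  | succ k ih =>
    rw [Function.iterate_succ_apply']
    exact (hf ih).trans hP

theorem iterate_bot_le_succ (hf : Monotone f) (k : ℕ) : f^[k] ⊥ ≤ f (f^[k] ⊥) := by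
  induction k with
  | zero => exact bot_le
  | succ k ih =>
    rw [Function.iterate_succ_apply']
    exact hf ih

/-- As long as the iteration has not become stationary, the total size of the family grows by at
least one, and it cannot exceed `m * n`. -/
theorem iterate_bot_isFixed (hf : Monotone f) : f (f^[m * n] ⊥) = f^[m * n] ⊥ := by
  by_contra hne
  have hstep : ∀ k ≤ m * n, f^[k] ⊥ < f (f^[k] ⊥) := by
    intro k hk
    refine lt_of_le_of_ne (iterate_bot_le_succ hf k) fun h => hne ?_
    obtain ⟨j, hj⟩ := Nat.exists_eq_add_of_le' hk
    have : f^[m * n] ⊥ = f^[k] ⊥ := by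
      rw [hj, Function.iterate_add_apply f j k]
      exact Function.iterate_fixed h.symm j
    rw [this, ← h]
  have hcard : ∀ k ≤ m * n + 1, k ≤ ∑ d, (f^[k] ⊥ d).card := by
    intro k
    induction k with
    | zero => intro _; exact Nat.zero_le _
    | succ k ih =>
      intro hk
      have hlt := hstep k (by omega)
      rw [Function.iterate_succ_apply']
      obtain ⟨hle, d, hd⟩ := Pi.lt_def.1 hlt
      have : ∑ d, (f^[k] ⊥ d).card < ∑ d, (f (f^[k] ⊥) d).card :=
        Finset.sum_lt_sum (fun d _ => Finset.card_le_card (hle d))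
          ⟨d, Finset.mem_univ d, Finset.card_lt_card hd⟩
      have := ih (by omega)
      omega
  have h1 := hcard _ le_rfl
  have h2 : ∑ d, (f^[m * n + 1] ⊥ d).card ≤ ∑ _d : Fin m, n :=
    Finset.sum_le_sum fun d _ => card_finset_fin_le _
  simp only [Finset.sum_const, Finset.card_univ, Fintype.card_fin, smul_eq_mul] at h2
  omega

end Iterate

/-! ### Initial segments of preference lists -/

/-- The `k` most preferred students of the list `l`. -/
def topStudents {n : ℕ} (l : Equiv.Perm (Fin n)) (k : ℕ) : Finset (Fin n) :=
  Finset.univ.filter fun s => (l.symm s : ℕ) < k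

section TopStudents

variable {n : ℕ} (l : Equiv.Perm (Fin n))

@[simp] theorem mem_topStudents {k : ℕ} {s : Fin n} :
    s ∈ topStudents l k ↔ (l.symm s : ℕ) < k := by
  simp [topStudents]

theorem topStudents_mono {k k' : ℕ} (h : k ≤ k') : topStudents l k ⊆ topStudents l k' := by
  intro s hs
  rw [mem_topStudents] at *
  omega

theorem card_topStudents (k : ℕ) : (topStudents l k).card = min n k := by
  have : topStudents l k = (Finset.univ.filter fun i : Fin n => (i : ℕ) < k).map l.toEmbedding := by
    ext s
    simp [topStudents, Finset.mem_map_equiv]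
  rw [this, Finset.card_map, Fin.card_filter_val_lt]

theorem card_filter_prefers_compl_topStudents (k : ℕ) {s : Fin n}
    (hs : s ∈ (topStudents l k)ᶜ) :
    ((topStudents l k)ᶜ.filter fun t => Prefers l t s).card = (l.symm s : ℕ) - k := by
  have h : (topStudents l k)ᶜ.filter (fun t => Prefers l t s) =
      topStudents l (l.symm s) \ topStudents l k := by
    ext t
    simp only [Finset.mem_filter, Finset.mem_compl, mem_topStudents, Finset.mem_sdiff, Prefers,
      Fin.lt_def]
    tauto
  rw [Finset.mem_compl, mem_topStudents, not_lt] at hs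
  rw [h, Finset.card_sdiff_of_subset (topStudents_mono l hs), card_topStudents, card_topStudents]
  have := (l.symm s).isLt
  omega

/-- Keeps the offers of a college an initial segment of its list from round to round, so that only
the number of offers matters. -/
theorem topStudents_union_favourites (k j : ℕ) :
    topStudents l k ∪ favourites l j (topStudents l k)ᶜ = topStudents l (k + j) := by
  ext s
  by_cases hs : s ∈ topStudents l k
  · have := topStudents_mono l (Nat.le_add_right k j) hs
    simp only [Finset.mem_union, hs, this, true_or]
  · have hs' := Finset.mem_compl.2 hs
    simp only [Finset.mem_union, hs, false_or, favourites, Finset.mem_filter, hs', true_and,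
      card_filter_prefers_compl_topStudents l k hs']
    simp only [mem_topStudents] at *
    omega

theorem favourites_univ (k : ℕ) : favourites l k Finset.univ = topStudents l k := by
  have h0 : topStudents l 0 = ∅ := by ext s; simp
  simpa [h0] using topStudents_union_favourites l 0 k

end TopStudents

namespace Market

variable {m n : ℕ} (M : Market m n)

/-! ### Offers as a least fixed point -/

/-- An offer that is not the best one remains so when further offers arrive. All monotonicity below
comes from this. -/
theorem rejecters_mono {O O' : Fin m → Finset (Fin n)} (h : O ≤ O') (d : Fin m) :
    M.rejecters O d ⊆ M.rejecters O' d := by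
  intro s hs
  simp only [rejecters, Finset.mem_filter] at *
  exact ⟨h d hs.1, fun hk => hs.2 ⟨hs.1, fun d' hd' => hk.2 d' (h d' hd')⟩⟩

theorem rejecters_subset (O : Fin m → Finset (Fin n)) (d : Fin m) : M.rejecters O d ⊆ O d :=
  Finset.filter_subset _ _

/-- Every college makes offers to so many of its favourites that it may fill its capacity in spite
of the rejections implied by the offers `O`. -/
def fullStep (O : Fin m → Finset (Fin n)) (d : Fin m) : Finset (Fin n) :=
  topStudents (M.collegeList d) (M.q d + (M.rejecters O d).card)

theorem fullStep_mono : Monotone M.fullStep := fun _ _ h d =>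
  topStudents_mono _ (Nat.add_le_add_left (Finset.card_le_card (M.rejecters_mono h d)) _)

/-- The offers made in deferred acceptance. -/
def finalOffers : Fin m → Finset (Fin n) := M.fullStep^[m * n] ⊥

theorem fullStep_finalOffers : M.fullStep M.finalOffers = M.finalOffers :=
  iterate_bot_isFixed M.fullStep_mono

theorem finalOffers_le {P : Fin m → Finset (Fin n)} (hP : M.fullStep P ≤ P) : M.finalOffers ≤ P :=
  iterate_bot_le M.fullStep_mono hP _

theorem rejecters_bot (d : Fin m) : M.rejecters ⊥ d = ∅ := by
  simp [rejecters]

/-- A round reacts only to new rejections, while `fullStep` recomputes the segment from all of them.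
They agree because the segment length is always the capacity plus the number of rejections already
answered. The index is shifted by one because the initial offers are already `fullStep ⊥`. -/
theorem daRound_iterate (k : ℕ) :
    (M.daRound^[k] M.daStart).offers = M.fullStep^[k + 1] ⊥ ∧
      ∀ d, (M.daRound^[k] M.daStart).rejected d ⊆
          M.rejecters (M.daRound^[k] M.daStart).offers d ∧
        (M.daRound^[k] M.daStart).offers d = topStudents (M.collegeList d)
          (M.q d + ((M.daRound^[k] M.daStart).rejected d).card) := by
  induction k with
  | zero =>
    refine ⟨?_, fun d => ⟨by simp [daStart], by simp [daStart, favourites_univ]⟩⟩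
    funext d
    simp [daStart, fullStep, favourites_univ, rejecters_bot]
  | succ k ih =>
    obtain ⟨ih1, ih2⟩ := ih
    rw [Function.iterate_succ_apply', Function.iterate_succ_apply' M.fullStep, ← ih1]
    set σ := M.daRound^[k] M.daStart
    have key : (M.daRound σ).offers = M.fullStep σ.offers := by
      funext d
      obtain ⟨hsub, hd⟩ := ih2 d
      have hcard := Finset.card_le_card hsub
      simp only [daRound, fullStep]
      rw [Finset.card_sdiff_of_subset hsub]
      conv_lhs => rw [hd]
      rw [topStudents_union_favourites]
      congr 1
      omega
    refine ⟨key, fun d => ⟨?_, ?_⟩⟩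
    · exact M.rejecters_mono (fun d => by simp [daRound]) d
    · rw [key]; rfl

theorem filter_keeps (O : Fin m → Finset (Fin n)) (d : Fin m) :
    (O d).filter (fun s => M.Keeps O s d) = O d \ M.rejecters O d := by
  rw [rejecters, Finset.filter_not, Finset.sdiff_sdiff_eq_self (Finset.filter_subset _ _)]

theorem collegeProposingDA_eq (d : Fin m) :
    M.collegeProposingDA d = M.finalOffers d \ M.rejecters M.finalOffers d := by
  have h : (M.daRound^[m * n] M.daStart).offers = M.finalOffers := by
    rw [(M.daRound_iterate _).1, Function.iterate_succ_apply']
    exact M.fullStep_finalOffers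
  simp only [collegeProposingDA, h]
  exact M.filter_keeps _ d

/-! ### Offers of one college as a parameter -/

/-- As `fullStep`, but the offers of `c` are `Y`. -/
def offerStep (c : Fin m) (Y : Finset (Fin n)) (O : Fin m → Finset (Fin n)) (d : Fin m) :
    Finset (Fin n) :=
  if d = c then Y else M.fullStep O d

theorem offerStep_mono {c : Fin m} {Y Y' : Finset (Fin n)} (hY : Y ⊆ Y')
    {O O' : Fin m → Finset (Fin n)} (h : O ≤ O') : M.offerStep c Y O ≤ M.offerStep c Y' O' := by
  intro d
  simp only [offerStep]
  split_ifs
  · exact hY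
  · exact M.fullStep_mono h d

/-- The offers made in deferred acceptance if `c` makes offers exactly to `Y`. -/
def offersWith (c : Fin m) (Y : Finset (Fin n)) : Fin m → Finset (Fin n) :=
  (M.offerStep c Y)^[m * n] ⊥

/-- The students whom `c` gets if it makes offers exactly to `Y`. -/
def chosen (c : Fin m) (Y : Finset (Fin n)) : Finset (Fin n) :=
  Y \ M.rejecters (M.offersWith c Y) c

variable (c : Fin m) {X Y : Finset (Fin n)}

theorem offerStep_offersWith (Y : Finset (Fin n)) :
    M.offerStep c Y (M.offersWith c Y) = M.offersWith c Y :=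
  iterate_bot_isFixed fun _ _ h => M.offerStep_mono subset_rfl h

theorem offersWith_le {P : Fin m → Finset (Fin n)} (hP : M.offerStep c Y P ≤ P) :
    M.offersWith c Y ≤ P :=
  iterate_bot_le (fun _ _ h => M.offerStep_mono subset_rfl h) hP _

theorem offersWith_self (Y : Finset (Fin n)) : M.offersWith c Y c = Y := by
  rw [← offerStep_offersWith]
  simp [offerStep]

theorem offersWith_of_ne {d : Fin m} (hd : d ≠ c) (Y : Finset (Fin n)) :
    M.offersWith c Y d = M.fullStep (M.offersWith c Y) d := by
  conv_lhs => rw [← offerStep_offersWith]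
  simp [offerStep, hd]

theorem offersWith_mono (h : X ⊆ Y) : M.offersWith c X ≤ M.offersWith c Y := by
  refine M.offersWith_le c ((M.offerStep_mono h le_rfl).trans ?_)
  rw [offerStep_offersWith]

theorem chosen_subset (Y : Finset (Fin n)) : M.chosen c Y ⊆ Y := Finset.sdiff_subset

/-- Substitutability: if `c` makes fewer offers, the other colleges make no additional ones, so a
student who stayed with `c` has no new reason to leave. -/
theorem mem_chosen_of_subset (h : X ⊆ Y) {s : Fin n} (hs : s ∈ M.chosen c Y) (hX : s ∈ X) :
    s ∈ M.chosen c X := by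
  simp only [chosen, Finset.mem_sdiff] at *
  exact ⟨hX, fun h' => hs.2 (M.rejecters_mono (M.offersWith_mono c h) c h')⟩

theorem chosen_idem (Y : Finset (Fin n)) : M.chosen c (M.chosen c Y) = M.chosen c Y :=
  (M.chosen_subset c _).antisymm fun _ hs =>
    M.mem_chosen_of_subset c (M.chosen_subset c Y) hs hs

/-- Every student with at least one offer keeps exactly one, namely the favourite. -/
theorem sum_card_kept (O : Fin m → Finset (Fin n)) :
    ∑ d, (O d \ M.rejecters O d).card = (Finset.univ.biUnion O).card := by
  rw [← Finset.card_biUnion]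
  · congr 1
    ext s
    simp only [Finset.mem_biUnion, Finset.mem_univ, true_and]
    constructor
    · rintro ⟨d, hd⟩
      exact ⟨d, (Finset.mem_sdiff.1 hd).1⟩
    · rintro ⟨d₀, hd₀⟩
      obtain ⟨d, hd, hmin⟩ := Finset.exists_min_image
        (Finset.univ.filter fun d => s ∈ O d) (fun d => (M.studentList s).symm d)
        ⟨d₀, by simpa using hd₀⟩
      simp only [Finset.mem_filter, Finset.mem_univ, true_and] at hd hmin
      refine ⟨d, ?_⟩
      rw [← filter_keeps, Finset.mem_filter]
      refine ⟨hd, hd, fun d' hd' => ?_⟩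
      rcases (hmin d' hd').eq_or_lt with h | h
      · exact Or.inl ((M.studentList s).symm.injective h).symm
      · exact Or.inr h
  · intro d _ d' _ hne
    rw [Function.onFun, Finset.disjoint_left]
    intro s hs hs'
    rw [← filter_keeps, Finset.mem_filter] at hs hs'
    rcases hs.2.2 d' hs'.1 with h | h
    · exact hne h.symm
    rcases hs'.2.2 d hs.1 with h' | h'
    · exact hne h'
    exact absurd h (not_lt.2 h'.le)

/-- Law of aggregate demand: with more offers from `c`, no fewer students hold an offer in total,
while every other college keeps no more students than before. The balance falls to `c`. -/
theorem card_chosen_mono (h : X ⊆ Y) : (M.chosen c X).card ≤ (M.chosen c Y).card := by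
  have hle := M.offersWith_mono c h
  set O := M.offersWith c X with hO
  set O' := M.offersWith c Y with hO'
  have hu : (Finset.univ.biUnion O).card ≤ (Finset.univ.biUnion O').card :=
    Finset.card_le_card (Finset.biUnion_mono fun d _ => hle d)
  rw [← sum_card_kept M, ← sum_card_kept M, ← Finset.add_sum_erase _ _ (Finset.mem_univ c),
    ← Finset.add_sum_erase _ _ (Finset.mem_univ c)] at hu
  -- With `r` rejections, another college keeps `min n (q + r) - r` students, which does not
  -- increase with `r`.
  have hrest : ∑ d ∈ Finset.univ.erase c, (O' d \ M.rejecters O' d).card ≤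
      ∑ d ∈ Finset.univ.erase c, (O d \ M.rejecters O d).card := by
    refine Finset.sum_le_sum fun d hd => ?_
    have hd := Finset.ne_of_mem_erase hd
    rw [Finset.card_sdiff_of_subset (M.rejecters_subset _ _),
      Finset.card_sdiff_of_subset (M.rejecters_subset _ _)]
    have h1 : (O d).card = min n (M.q d + (M.rejecters O d).card) := by
      conv_lhs => rw [hO, M.offersWith_of_ne c hd]
      exact card_topStudents _ _
    have h2 : (O' d).card = min n (M.q d + (M.rejecters O' d).card) := by
      conv_lhs => rw [hO', M.offersWith_of_ne c hd]
      exact card_topStudents _ _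
    have := Finset.card_le_card (M.rejecters_mono hle d)
    omega
  have e1 : O c = X := M.offersWith_self c X
  have e2 : O' c = Y := M.offersWith_self c Y
  rw [e1, e2] at hu
  rw [chosen, chosen, ← hO, ← hO']
  omega

theorem card_chosen_le_card_of_chosen_subset (h : M.chosen c Y ⊆ X) :
    (M.chosen c Y).card ≤ (M.chosen c X).card := by
  rw [← M.chosen_idem c Y]
  exact M.card_chosen_mono c h

/-- Substitutability gives one inclusion, and aggregate demand excludes that it is strict. -/
theorem chosen_eq_of_chosen_subset (hX : X ⊆ Y) (h : M.chosen c Y ⊆ X) :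
    M.chosen c X = M.chosen c Y :=
  (Finset.eq_of_subset_of_card_le (fun _ hs => M.mem_chosen_of_subset c hX hs (h hs))
    (M.card_chosen_mono c hX)).symm

/-! ### Reports -/

variable (p : Equiv.Perm (Fin n))

theorem misreport_self : M.misreport c (M.collegeList c) = M := by
  cases M
  simp [misreport]

theorem rejecters_misreport : (M.misreport c p).rejecters = M.rejecters := rfl

theorem fullStep_misreport_of_ne {d : Fin m} (hd : d ≠ c) (O : Fin m → Finset (Fin n)) :
    (M.misreport c p).fullStep O d = M.fullStep O d := by
  simp [fullStep, misreport, hd, Keeps, rejecters]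

theorem fullStep_misreport_self (O : Fin m → Finset (Fin n)) :
    (M.misreport c p).fullStep O c = topStudents p (M.q c + (M.rejecters O c).card) := by
  simp [fullStep, misreport, rejecters, Keeps]

/-- The students to whom `c` makes offers if it reports `p`. -/
def reportOffers : Finset (Fin n) := (M.misreport c p).finalOffers c

/-- Both sides are least fixed points, and each is closed under the operator of the other. -/
theorem finalOffers_misreport :
    (M.misreport c p).finalOffers = M.offersWith c (M.reportOffers c p) := by
  set O := (M.misreport c p).finalOffers with hO
  have hfix : (M.misreport c p).fullStep O = O := fullStep_finalOffers _
  have hle : M.offersWith c (M.reportOffers c p) ≤ O := by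
    refine M.offersWith_le c fun d => ?_
    by_cases hd : d = c
    · subst hd
      simp [offerStep, reportOffers, hO]
    · conv_rhs => rw [← hfix, fullStep_misreport_of_ne _ _ _ hd]
      simp [offerStep, hd]
  refine le_antisymm (finalOffers_le _ fun d => ?_) hle
  by_cases hd : d = c
  · subst hd
    rw [offersWith_self, fullStep_misreport_self, reportOffers, ← hO]
    conv_rhs => rw [← hfix, fullStep_misreport_self]
    exact topStudents_mono _ (Nat.add_le_add_left (Finset.card_le_card (M.rejecters_mono hle d)) _)
  · rw [fullStep_misreport_of_ne _ _ _ hd, M.offersWith_of_ne c hd]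

theorem outcomeOfReport_eq : M.outcomeOfReport c p = M.chosen c (M.reportOffers c p) := by
  rw [outcomeOfReport, collegeProposingDA_eq, finalOffers_misreport, rejecters_misreport, chosen,
    offersWith_self]

theorem reportOffers_eq : M.reportOffers c p = topStudents p
    (M.q c + (M.rejecters (M.offersWith c (M.reportOffers c p)) c).card) := by
  conv_lhs => rw [reportOffers, ← fullStep_finalOffers, fullStep_misreport_self,
    finalOffers_misreport]

theorem card_outcomeOfReport_le : (M.outcomeOfReport c p).card ≤ M.q c := by
  rw [outcomeOfReport_eq, chosen]
  have hsub := M.rejecters_subset (M.offersWith c (M.reportOffers c p)) c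
  rw [offersWith_self] at hsub
  rw [Finset.card_sdiff_of_subset hsub]
  have := congrArg Finset.card (M.reportOffers_eq c p)
  rw [card_topStudents] at this
  omega

/-- A vacancy remains only if the initial segment of offers was cut off by the end of the list. -/
theorem reportOffers_eq_univ (h : (M.outcomeOfReport c p).card < M.q c) :
    M.reportOffers c p = Finset.univ := by
  rw [outcomeOfReport_eq, chosen] at h
  have hsub := M.rejecters_subset (M.offersWith c (M.reportOffers c p)) c
  rw [offersWith_self] at hsub
  rw [Finset.card_sdiff_of_subset hsub] at h
  have := congrArg Finset.card (M.reportOffers_eq c p)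
  rw [card_topStudents] at this
  rw [← Finset.card_eq_iff_eq_univ, Fintype.card_fin]
  omega

/-- If `c` cannot fill its capacity, all reports have the same outcome. -/
theorem outcomeOfReport_of_card_lt (h : (M.chosen c Finset.univ).card < M.q c) :
    M.outcomeOfReport c p = M.chosen c Finset.univ := by
  have hlt : (M.outcomeOfReport c p).card < M.q c := by
    rw [outcomeOfReport_eq]
    exact (M.card_chosen_mono c (Finset.subset_univ _)).trans_lt h
  rw [outcomeOfReport_eq, M.reportOffers_eq_univ c p hlt]

theorem card_outcomeOfReport (h : M.q c ≤ (M.chosen c Finset.univ).card) :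
    (M.outcomeOfReport c p).card = M.q c := by
  refine (M.card_outcomeOfReport_le c p).antisymm (not_lt.1 fun hlt => ?_)
  have h1 := M.reportOffers_eq_univ c p hlt
  rw [outcomeOfReport_eq, h1] at hlt
  omega

theorem chosen_outcomeOfReport :
    M.chosen c (M.outcomeOfReport c p) = M.outcomeOfReport c p := by
  rw [outcomeOfReport_eq, chosen_idem]

/-- A set of `q c` students who all accept `c` is the outcome of any report that starts with it. -/
theorem outcomeOfReport_of_topStudents {T : Finset (Fin n)} (hT : M.chosen c T = T)
    (hp : topStudents p (M.q c) = T) : M.outcomeOfReport c p = T := by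
  have hrej : M.rejecters (M.offersWith c T) c = ∅ := by
    have hsub := M.rejecters_subset (M.offersWith c T) c
    rw [offersWith_self] at hsub
    rw [chosen, Finset.sdiff_eq_self_iff_disjoint] at hT
    exact Finset.disjoint_self_iff_empty _ |>.1 (hT.mono_left hsub)
  have hle : (M.misreport c p).finalOffers ≤ M.offersWith c T := by
    refine finalOffers_le _ fun d => ?_
    by_cases hd : d = c
    · subst hd
      rw [fullStep_misreport_self, hrej, offersWith_self, Finset.card_empty, add_zero, hp]
    · rw [fullStep_misreport_of_ne _ _ _ hd, M.offersWith_of_ne c hd]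
  have h1 : M.reportOffers c p ⊆ T := by
    have := hle c
    rwa [offersWith_self] at this
  have h2 : T ⊆ M.reportOffers c p := by
    rw [reportOffers_eq, ← hp]
    exact topStudents_mono _ (Nat.le_add_right _ _)
  rw [outcomeOfReport_eq, h1.antisymm h2, hT]

end Market

/-! ### Responsive preferences -/

section Responsive

variable {n : ℕ} {l : Equiv.Perm (Fin n)} {q : ℕ} {X Y : Finset (Fin n)}

/-- A necessary condition for being better that passes to the transitive closure; it is what refutes
improvements of the survivors. -/
theorem ResponsiveStep.card_inter_topStudents_le (h : ResponsiveStep l q X Y) (j : ℕ) :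
    (Y ∩ topStudents l j).card ≤ (X ∩ topStudents l j).card := by
  cases h with
  | replace X s s' hX hs hs' h =>
    by_cases h1 : s' ∈ topStudents l j
    · have h2 : s ∈ topStudents l j := by
        rw [mem_topStudents] at *
        exact (Fin.lt_def.1 h).trans h1
      rw [Finset.insert_inter_of_mem h1, Finset.insert_inter_of_mem h2,
        Finset.card_insert_of_notMem (by simp [hs']), Finset.card_insert_of_notMem (by simp [hs])]
    · rw [Finset.insert_inter_of_notMem h1]
      exact Finset.card_le_card (Finset.inter_subset_inter_right (Finset.subset_insert _ _))
  | add X s hX hs =>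
    exact Finset.card_le_card (Finset.inter_subset_inter_right (Finset.subset_insert _ _))

theorem ResponsivelyBetter.card_inter_topStudents_le (h : ResponsivelyBetter l q X Y) (j : ℕ) :
    (Y ∩ topStudents l j).card ≤ (X ∩ topStudents l j).card := by
  induction h with
  | single h => exact h.card_inter_topStudents_le j
  | tail _ h ih => exact (h.card_inter_topStudents_le j).trans ih

/-- The weights `n - position` are positive and decrease along the list, so their sum is a strict
potential. It makes the transitive closure irreflexive. -/
theorem ResponsiveStep.sum_lt (h : ResponsiveStep l q X Y) :
    ∑ s ∈ Y, (n - (l.symm s : ℕ)) < ∑ s ∈ X, (n - (l.symm s : ℕ)) := by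
  cases h with
  | replace X s s' hX hs hs' h =>
    rw [Finset.sum_insert hs, Finset.sum_insert hs']
    have := Fin.lt_def.1 h
    have := (l.symm s').isLt
    omega
  | add X s hX hs =>
    rw [Finset.sum_insert hs]
    have := (l.symm s).isLt
    omega

theorem ResponsivelyBetter.sum_lt (h : ResponsivelyBetter l q X Y) :
    ∑ s ∈ Y, (n - (l.symm s : ℕ)) < ∑ s ∈ X, (n - (l.symm s : ℕ)) := by
  induction h with
  | single h => exact h.sum_lt
  | tail _ h ih => exact h.sum_lt.trans ih

theorem ResponsivelyBetter.ne (h : ResponsivelyBetter l q X Y) : X ≠ Y := by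
  rintro rfl
  exact lt_irrefl _ h.sum_lt

end Responsive

/-! ### Greedy deletion of the least preferred students -/

namespace Market

variable {m n : ℕ} (M : Market m n) (c : Fin m)

/-- Delete `s` from `Y` if `c` can still fill its capacity. -/
def deleteStep (s : Fin n) (Y : Finset (Fin n)) : Finset (Fin n) :=
  if (M.chosen c (Y.erase s)).card < M.q c then Y else Y.erase s

/-- The students that are left after the attempts to delete the `j` least preferred students, one
by one, beginning with the last one. -/
def survivors : ℕ → Finset (Fin n)
  | 0 => Finset.univ
  | j + 1 =>
    if h : j < n then M.deleteStep c (M.collegeList c ⟨n - 1 - j, by omega⟩) (survivors j)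
    else survivors j

theorem deleteStep_subset (s : Fin n) (Y : Finset (Fin n)) : M.deleteStep c s Y ⊆ Y := by
  rw [deleteStep]
  split_ifs
  · exact subset_rfl
  · exact Finset.erase_subset _ _

theorem survivors_antitone : Antitone (M.survivors c) := by
  refine antitone_nat_of_succ_le fun j => ?_
  rw [survivors]
  split_ifs
  · exact M.deleteStep_subset c _ _
  · exact le_rfl

theorem survivors_succ {j : ℕ} {s : Fin n} (hs : ((M.collegeList c).symm s : ℕ) + j + 1 = n) :
    M.survivors c (j + 1) = M.deleteStep c s (M.survivors c j) := by
  have hj : j < n := by omega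
  have : M.collegeList c ⟨n - 1 - j, by omega⟩ = s := by
    rw [← Equiv.eq_symm_apply]
    ext
    simp only
    omega
  rw [survivors, dif_pos hj, this]

theorem exists_student_at {j : ℕ} (hj : j < n) :
    ∃ s : Fin n, ((M.collegeList c).symm s : ℕ) + j + 1 = n :=
  ⟨M.collegeList c ⟨n - 1 - j, by omega⟩, by simp only [Equiv.symm_apply_apply]; omega⟩

theorem mem_survivors_of_lt {j : ℕ} {s : Fin n} (h : ((M.collegeList c).symm s : ℕ) + j < n) :
    s ∈ M.survivors c j := by
  induction j with
  | zero => simp [survivors]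
  | succ j ih =>
    obtain ⟨t, ht⟩ := M.exists_student_at c (j := j) (by omega)
    rw [M.survivors_succ c ht, deleteStep]
    have hs := ih (by omega)
    split_ifs
    · exact hs
    · refine Finset.mem_erase.2 ⟨?_, hs⟩
      rintro rfl
      omega

theorem card_chosen_erase_survivors {j k : ℕ} {s : Fin n}
    (hj : ((M.collegeList c).symm s : ℕ) + j + 1 = n) (hk : j < k) (hs : s ∈ M.survivors c k) :
    (M.chosen c ((M.survivors c j).erase s)).card < M.q c := by
  have h := M.survivors_antitone c (Nat.succ_le_of_lt hk) hs
  rw [Nat.succ_eq_add_one, M.survivors_succ c hj, deleteStep] at h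
  by_contra hlt
  rw [if_neg hlt] at h
  exact Finset.notMem_erase _ _ h

/-- An attempt that failed would still fail later: the set of survivors has only shrunk, so
aggregate demand applies. -/
theorem card_chosen_erase_survivors_self {k : ℕ} {s : Fin n}
    (hk : n ≤ ((M.collegeList c).symm s : ℕ) + k) (hs : s ∈ M.survivors c k) :
    (M.chosen c ((M.survivors c k).erase s)).card < M.q c := by
  have hlt := ((M.collegeList c).symm s).isLt
  obtain ⟨j, hj⟩ := Nat.exists_eq_add_of_lt hlt
  have := M.card_chosen_erase_survivors c hj.symm (by omega) hs
  exact (M.card_chosen_mono c (Finset.erase_subset_erase _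
    (M.survivors_antitone c (by omega)))).trans_lt this

/-- A student who leaves `c` anyway can be deleted without loss, so a tested student who survives
must be chosen. -/
theorem chosen_survivors {j : ℕ} {s : Fin n} (h : M.q c ≤ (M.chosen c (M.survivors c j)).card)
    (hs : s ∈ M.survivors c j) (hj : n ≤ ((M.collegeList c).symm s : ℕ) + j) :
    s ∈ M.chosen c (M.survivors c j) := by
  by_contra hn
  have h1 := M.card_chosen_erase_survivors_self c hj hs
  have h2 := M.card_chosen_le_card_of_chosen_subset c (X := (M.survivors c j).erase s)
    fun t ht => Finset.mem_erase.2 ⟨fun e => hn (e ▸ ht), M.chosen_subset c _ ht⟩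
  omega

/-- The truthful outcome, or a better one. -/
abbrev AtLeastTruthful (T : Finset (Fin n)) : Prop :=
  T = M.collegeProposingDA c ∨
    ResponsivelyBetter (M.collegeList c) (M.q c) T (M.collegeProposingDA c)

variable {M c}

/-- By substitutability, all chosen students other than `s` remain chosen. If `s` was chosen, the
sizes force exactly one replacement, who comes from the previously unchosen students of `Y` and is
therefore preferred to `s`. -/
theorem AtLeastTruthful.chosen_erase {Y : Finset (Fin n)} {s : Fin n}
    (hT : M.AtLeastTruthful c (M.chosen c Y)) (hcard : (M.chosen c Y).card = M.q c)
    (hs : M.q c ≤ (M.chosen c (Y.erase s)).card)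
    (hY : ∀ t ∈ Y, t ∉ M.chosen c Y → t ≠ s → Prefers (M.collegeList c) t s) :
    (M.chosen c (Y.erase s)).card = M.q c ∧ M.AtLeastTruthful c (M.chosen c (Y.erase s)) := by
  have hle := M.card_chosen_mono c (Finset.erase_subset s Y)
  refine ⟨by omega, ?_⟩
  by_cases hsY : s ∈ M.chosen c Y
  · have hsub : (M.chosen c Y).erase s ⊆ M.chosen c (Y.erase s) := fun t ht =>
      M.mem_chosen_of_subset c (Finset.erase_subset s Y) (Finset.mem_of_mem_erase ht)
        (Finset.mem_erase.2 ⟨Finset.ne_of_mem_erase ht,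
          M.chosen_subset c _ (Finset.mem_of_mem_erase ht)⟩)
    have hq := M.one_le_q c
    have hce := Finset.card_erase_of_mem hsY
    obtain ⟨w, hw⟩ := Finset.card_eq_one.1
      (show (M.chosen c (Y.erase s) \ (M.chosen c Y).erase s).card = 1 by
        rw [Finset.card_sdiff_of_subset hsub]; omega)
    have hw' : w ∈ M.chosen c (Y.erase s) \ (M.chosen c Y).erase s := by simp [hw]
    rw [Finset.mem_sdiff] at hw'
    have hwY := M.chosen_subset c _ hw'.1
    have hws := Finset.ne_of_mem_erase hwY
    have hpref := hY w (Finset.mem_of_mem_erase hwY)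
      (fun h => hw'.2 (Finset.mem_erase.2 ⟨hws, h⟩)) hws
    have heq : M.chosen c (Y.erase s) = insert w ((M.chosen c Y).erase s) := by
      rw [← Finset.sdiff_union_of_subset hsub, hw]; rfl
    have hstep : ResponsiveStep (M.collegeList c) (M.q c) (M.chosen c (Y.erase s))
        (M.chosen c Y) := by
      rw [heq]
      conv => arg 4; rw [← Finset.insert_erase hsY]
      exact .replace _ _ _ (by omega) hw'.2 (Finset.notMem_erase _ _) hpref
    rcases hT with hT | hT
    · exact Or.inr (hT ▸ .single hstep)
    · exact Or.inr (.head hstep hT)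
  · rwa [M.chosen_eq_of_chosen_subset c (Finset.erase_subset s Y) fun t ht =>
      Finset.mem_erase.2 ⟨fun e => hsY (e ▸ ht), M.chosen_subset c _ ht⟩]

variable (M c)

theorem q_le_card_chosen_survivors (h : M.q c ≤ (M.chosen c Finset.univ).card) (j : ℕ) :
    M.q c ≤ (M.chosen c (M.survivors c j)).card := by
  induction j with
  | zero => exact h
  | succ j ih =>
    by_cases hj : j < n
    · obtain ⟨s, hs⟩ := M.exists_student_at c hj
      rw [M.survivors_succ c hs, deleteStep]
      split_ifs with hlt
      · exact ih
      · omega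
    · rwa [survivors, dif_neg hj]

/-- The truthful offers `X` form an initial segment, so students outside `X` are tested first. The
third conjunct records that those already tested are gone; hence only `X` remains once a student of
`X` is tested. -/
theorem survivors_inter_reportOffers (h : M.q c ≤ (M.chosen c Finset.univ).card) {j : ℕ}
    (hj : j ≤ n) :
    let X := M.reportOffers c (M.collegeList c)
    (M.chosen c (X ∩ M.survivors c j)).card = M.q c ∧
      M.AtLeastTruthful c (M.chosen c (X ∩ M.survivors c j)) ∧
      ∀ s ∈ M.survivors c j, s ∉ X → ((M.collegeList c).symm s : ℕ) + j < n := by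
  intro X
  have htop : X = topStudents (M.collegeList c) _ := M.reportOffers_eq c _
  induction j with
  | zero =>
    have e : M.collegeProposingDA c = M.chosen c X := by
      rw [← outcomeOfReport_eq, outcomeOfReport, misreport_self]
    simp only [survivors, Finset.inter_univ]
    refine ⟨?_, Or.inl e.symm, fun s _ _ => by simp⟩
    rw [← outcomeOfReport_eq]
    exact M.card_outcomeOfReport c _ h
  | succ j ih =>
    obtain ⟨ih1, ih2, ih3⟩ := ih (by omega)
    obtain ⟨s, hs⟩ := M.exists_student_at c (j := j) (by omega)
    by_cases hsX : s ∈ X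
    · have hsub : M.survivors c j ⊆ X := by
        intro t ht
        by_contra htX
        have := ih3 t ht htX
        rw [htop, mem_topStudents] at hsX htX
        omega
      rw [Finset.inter_eq_right.2 hsub] at ih1 ih2
      rw [Finset.inter_eq_right.2 ((M.survivors_antitone c j.le_succ).trans hsub)]
      refine ⟨?_, ?_, fun t ht htX =>
        absurd (hsub (M.survivors_antitone c j.le_succ ht)) htX⟩
      all_goals
        rw [M.survivors_succ c hs, deleteStep]
        split_ifs with hlt
        · assumption
        have := ih2.chosen_erase ih1 (not_lt.1 hlt) fun t ht htc hts => by
          -- A student `t` who is not preferred to `s` was tested before `s`, hence is chosen by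
          -- `chosen_survivors`.
          by_contra hnot
          refine htc (M.chosen_survivors c ih1.ge ht ?_)
          rw [Prefers, Fin.lt_def] at hnot
          have : ((M.collegeList c).symm t : ℕ) ≠ (M.collegeList c).symm s := fun e =>
            hts ((M.collegeList c).symm.injective (Fin.ext e))
          omega
      · exact this.1
      · exact this.2
    -- Here `s` lies outside `X`: the survivors in `X` alone already fill the capacity, so `s` is
    -- deleted and the intersection with `X` does not change.
    · have hXs : X ∩ M.survivors c j ⊆ (M.survivors c j).erase s := fun t ht => by
        rw [Finset.mem_inter] at ht
        exact Finset.mem_erase.2 ⟨fun e => hsX (e ▸ ht.1), ht.2⟩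
      have hcard : ¬ (M.chosen c ((M.survivors c j).erase s)).card < M.q c := by
        have := M.card_chosen_mono c hXs
        omega
      have heq : X ∩ (M.survivors c j).erase s = X ∩ M.survivors c j := by
        rw [Finset.inter_erase, Finset.erase_eq_of_notMem fun h => hsX (Finset.mem_inter.1 h).1]
      rw [M.survivors_succ c hs, deleteStep, if_neg hcard, heq]
      refine ⟨ih1, ih2, fun t ht htX => ?_⟩
      rw [Finset.mem_erase] at ht
      have := ih3 t ht.2 htX
      have : ((M.collegeList c).symm t : ℕ) ≠ (M.collegeList c).symm s := fun e =>
        ht.1 ((M.collegeList c).symm.injective (Fin.ext e))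
      omega

theorem survivors_spec (h : M.q c ≤ (M.chosen c Finset.univ).card) :
    (M.survivors c n).card = M.q c ∧ M.chosen c (M.survivors c n) = M.survivors c n ∧
      M.AtLeastTruthful c (M.survivors c n) := by
  have h0 := M.q_le_card_chosen_survivors c h n
  have h1 : M.chosen c (M.survivors c n) = M.survivors c n :=
    (M.chosen_subset c _).antisymm fun s hs => M.chosen_survivors c h0 hs (by omega)
  obtain ⟨h2, h3, h4⟩ := M.survivors_inter_reportOffers c h le_rfl
  rw [Finset.inter_eq_right.2, h1] at h2 h3
  · exact ⟨h2, h1, h3⟩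
  all_goals
    intro s hs
    by_contra hX
    have := h4 s hs hX
    omega

theorem not_responsivelyBetter_survivors {T : Finset (Fin n)} (hT : M.chosen c T = T)
    (hcard : T.card = M.q c) (hcard' : (M.survivors c n).card = M.q c) :
    ¬ ResponsivelyBetter (M.collegeList c) (M.q c) T (M.survivors c n) := by
  intro hb
  set S := M.survivors c n with hS
  set l := M.collegeList c with hl
  have hne : (symmDiff T S).Nonempty := by
    rw [Finset.nonempty_iff_ne_empty]
    intro h0
    exact hb.ne (symmDiff_eq_bot.1 h0)
  obtain ⟨s, hs, hmax⟩ := Finset.exists_max_image (symmDiff T S) (fun s => l.symm s) hne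
  have hrest : ∀ t, l.symm s < l.symm t → (t ∈ T ↔ t ∈ S) := by
    intro t ht
    by_contra hiff
    have : t ∈ symmDiff T S := by
      rw [Finset.mem_symmDiff]
      tauto
    exact absurd (hmax t this) (not_le.2 ht)
  rcases Finset.mem_symmDiff.1 hs with ⟨hsT, hsS⟩ | ⟨hsS, hsT⟩
  · have hle := hb.card_inter_topStudents_le (l.symm s)
    have hsub : S \ topStudents l (l.symm s) ⊂ T \ topStudents l (l.symm s) := by
      rw [Finset.ssubset_iff_of_subset]
      · exact ⟨s, by simp [hsT], by simp [hsS]⟩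
      · intro t ht
        rw [Finset.mem_sdiff, mem_topStudents, not_lt] at *
        refine ⟨(hrest t (lt_of_le_of_ne (Fin.le_def.2 ht.2) fun e => ?_)).2 ht.1, ht.2⟩
        rw [l.symm.injective e] at hsS
        exact hsS ht.1
    have h1 := Finset.card_lt_card hsub
    have h2 := Finset.card_inter_add_card_sdiff S (topStudents l (l.symm s))
    have h3 := Finset.card_inter_add_card_sdiff T (topStudents l (l.symm s))
    omega
  · have hlt := (l.symm s).isLt
    obtain ⟨j, hj⟩ := Nat.exists_eq_add_of_lt hlt
    have h1 := M.card_chosen_erase_survivors c hj.symm (by omega) hsS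
    have hsub : T ⊆ (M.survivors c j).erase s := by
      intro t ht
      have hts : t ≠ s := fun e => hsT (e ▸ ht)
      refine Finset.mem_erase.2 ⟨hts, ?_⟩
      -- Students preferred to `s` have not been tested by step `j`; on those after `s`, the set `T`
      -- agrees with the final survivors.
      rcases lt_or_gt_of_ne (fun e => hts (l.symm.injective e) : l.symm t ≠ l.symm s) with hc | hc
      · refine M.mem_survivors_of_lt c ?_
        rw [Fin.lt_def] at hc
        rw [← hl]
        omega
      · exact M.survivors_antitone c (by omega) ((hrest t hc).1 ht)
    have h2 := M.card_chosen_mono c hsub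
    rw [hT] at h2
    omega

/-- A report that begins with the surviving students is an optimal manipulation. -/
theorem isOptimalManipulation_of_topStudents {p : Equiv.Perm (Fin n)}
    (hp : topStudents p (M.survivors c n).card = M.survivors c n) :
    M.IsOptimalManipulation c p := by
  -- If the capacity cannot be filled, all reports have the same outcome, whatever the survivors
  -- are.
  rcases lt_or_ge (M.chosen c Finset.univ).card (M.q c) with h | h
  · have heq := fun p' => M.outcomeOfReport_of_card_lt c p' h
    refine ⟨Or.inl ?_, fun p' hb => hb.ne (by rw [heq, heq])⟩
    rw [heq, ← heq (M.collegeList c), outcomeOfReport, misreport_self]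
  · obtain ⟨h1, h2, h3⟩ := M.survivors_spec c h
    have hout := M.outcomeOfReport_of_topStudents c p h2 (h1 ▸ hp)
    rw [IsOptimalManipulation, hout]
    exact ⟨h3, fun p' => M.not_responsivelyBetter_survivors c (M.chosen_outcomeOfReport c p')
      (M.card_outcomeOfReport c p' h) h1⟩

end Market

/-! ### A language of bounded loops and its compilation -/

/-- Bounds by polynomials, up to a shift of the argument. -/
def PolyBounded (f : ℕ → ℕ) : Prop :=
  ∃ A d : ℕ, ∀ B, f B ≤ A * (B + 1) ^ d

theorem PolyBounded.const (k : ℕ) : PolyBounded fun _ => k := ⟨k, 0, by simp⟩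

theorem PolyBounded.id : PolyBounded fun B => B := ⟨1, 1, by simp⟩

theorem PolyBounded.add {f g : ℕ → ℕ} (hf : PolyBounded f) (hg : PolyBounded g) :
    PolyBounded fun B => f B + g B := by
  obtain ⟨A, d, hf⟩ := hf
  obtain ⟨A', d', hg⟩ := hg
  refine ⟨A + A', d + d', fun B => (Nat.add_le_add (hf B) (hg B)).trans ?_⟩
  have h := Nat.one_le_pow d (B + 1) (by omega)
  have h' := Nat.one_le_pow d' (B + 1) (by omega)
  rw [pow_add, add_mul]
  exact Nat.add_le_add (Nat.mul_le_mul_left _ (Nat.le_mul_of_pos_right _ h'))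
    (Nat.mul_le_mul_left _ (Nat.le_mul_of_pos_left _ h))

theorem PolyBounded.mul {f g : ℕ → ℕ} (hf : PolyBounded f) (hg : PolyBounded g) :
    PolyBounded fun B => f B * g B := by
  obtain ⟨A, d, hf⟩ := hf
  obtain ⟨A', d', hg⟩ := hg
  refine ⟨A * A', d + d', fun B => (Nat.mul_le_mul (hf B) (hg B)).trans (le_of_eq ?_)⟩
  ring

namespace RAM

/-- The register `z` counts down. Each pass costs at most `T` steps and one test, and the final test
costs one more. -/
theorem exec_loop {N T z : ℕ} {c : Cmd} (Inv : ℕ → State → Prop)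
    (hz : ∀ k σ, Inv k σ → σ.reg z = N - k)
    (hstep : ∀ k σ, k < N → Inv k σ → ∃ τ t, Exec c σ τ t ∧ t ≤ T ∧ Inv (k + 1) τ)
    {k : ℕ} (hk : k ≤ N) {σ : State} (hσ : Inv k σ) :
    ∃ τ t, Exec (.loop z c) σ τ t ∧ t ≤ (N - k) * (T + 1) + 1 ∧ Inv N τ := by
  induction hr : N - k generalizing k σ with
  | zero =>
    obtain rfl : k = N := by omega
    refine ⟨σ, 1, ?_, by omega, hσ⟩
    constructor
    rw [hz k σ hσ, hr]
  | succ r ih =>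
    obtain ⟨τ, t, E, ht, hτ⟩ := hstep k σ (by omega) hσ
    obtain ⟨τ', t', E', ht', hτ'⟩ := ih (k := k + 1) (by omega) hτ (by omega)
    refine ⟨τ', _, .loop_step (by rw [hz k σ hσ, hr]; omega) E E', ?_, hτ'⟩
    rw [Nat.succ_mul]
    omega

/-- Expressions over named registers and memory. In `sum i b e` the register `i` runs through the
numbers below the content of the register `b`. -/
inductive Expr : Type
  | lit (k : ℕ)
  | reg (i : ℕ)
  | add (e f : Expr)
  | sub (e f : Expr)
  | load (e : Expr)
  | ite (e f g : Expr)
  | sum (i b : ℕ) (e : Expr)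

namespace Expr

/-- The value of an expression. -/
def eval : Expr → (ℕ → ℕ) → (ℕ → ℕ) → ℕ
  | lit k, _, _ => k
  | reg i, ρ, _ => ρ i
  | add e f, ρ, μ => e.eval ρ μ + f.eval ρ μ
  | sub e f, ρ, μ => e.eval ρ μ - f.eval ρ μ
  | load e, ρ, μ => μ (e.eval ρ μ)
  | ite e f g, ρ, μ => if e.eval ρ μ ≠ 0 then f.eval ρ μ else g.eval ρ μ
  | sum i b e, ρ, μ => ∑ k ∈ Finset.range (ρ b), e.eval (Function.update ρ i k) μ

/-- All named registers are below `K`, and loops are bounded by the registers `0` and `1`, which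
are not changed. -/
def WF (K : ℕ) : Expr → Prop
  | lit _ => True
  | reg i => i < K
  | add e f => e.WF K ∧ f.WF K
  | sub e f => e.WF K ∧ f.WF K
  | load e => e.WF K
  | ite e f g => e.WF K ∧ f.WF K ∧ g.WF K
  | sum i b e => 2 ≤ i ∧ i < K ∧ b < 2 ∧ e.WF K

/-- Evaluation into the register `x`, with auxiliary registers above `x`. -/
def compile : Expr → ℕ → Cmd
  | lit k, x => .const x k
  | reg i, x => .copy x i
  | add e f, x => .seq (e.compile x) (.seq (f.compile (x + 1)) (.add x x (x + 1)))
  | sub e f, x => .seq (e.compile x) (.seq (f.compile (x + 1)) (.sub x x (x + 1)))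
  | load e, x => .seq (e.compile x) (.load x x)
  | ite e f g, x => .seq (e.compile x) (.ite x (f.compile x) (g.compile x))
  | sum i b e, x =>
    .seq (.const x 0) (.seq (.copy (x + 1) b) (.seq (.copy (x + 2) i) (.seq (.const i 0)
      (.seq (.loop (x + 1) (.seq (e.compile (x + 3)) (.seq (.add x x (x + 3))
        (.seq (.const (x + 3) 1) (.seq (.add i i (x + 3)) (.sub (x + 1) (x + 1) (x + 3)))))))
        (.copy i (x + 2))))))

/-- A bound for the time to evaluate an expression, if all loops are bounded by `B`. -/
def cost (B : ℕ) : Expr → ℕ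
  | lit _ => 1
  | reg _ => 1
  | add e f => e.cost B + f.cost B + 2
  | sub e f => e.cost B + f.cost B + 2
  | load e => e.cost B + 1
  | ite e f g => e.cost B + f.cost B + g.cost B + 1
  | sum _ _ e => B * (e.cost B + 5) + 6

theorem polyBounded_cost (e : Expr) : PolyBounded fun B => e.cost B := by
  induction e with
  | lit k => exact .const 1
  | reg i => exact .const 1
  | add e f he hf => exact (he.add hf).add (.const 2)
  | sub e f he hf => exact (he.add hf).add (.const 2)
  | load e he => exact he.add (.const 1)
  | ite e f g he hf hg => exact ((he.add hf).add hg).add (.const 1)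
  | sum i b e he => exact (PolyBounded.id.mul (he.add (.const 5))).add (.const 6)

/-- Makes values independent of the auxiliary registers that compiled code overwrites. -/
theorem eval_congr {K : ℕ} {e : Expr} (he : e.WF K) {ρ ρ' : ℕ → ℕ} (μ : ℕ → ℕ)
    (h : ∀ y < K, ρ y = ρ' y) : e.eval ρ μ = e.eval ρ' μ := by
  induction e generalizing ρ ρ' with
  | lit k => rfl
  | reg i => exact h i he
  | add e f ihe ihf => simp only [eval, ihe he.1 h, ihf he.2 h]
  | sub e f ihe ihf => simp only [eval, ihe he.1 h, ihf he.2 h]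
  | load e ih => simp only [eval, ih he h]
  | ite e f g ihe ihf ihg => simp only [eval, ihe he.1 h, ihf he.2.1 h, ihg he.2.2 h]
  | sum i b e ih =>
    obtain ⟨h2, hi, hb, he⟩ := he
    simp only [eval, h b (by omega)]
    refine Finset.sum_congr rfl fun k _ => ih he fun y hy => ?_
    simp only [Function.update_apply, h y hy]

theorem exec_compile {K B : ℕ} (hK : 2 ≤ K) (e : Expr) (he : e.WF K) {x : ℕ} (hx : K ≤ x)
    (σ : State) (h0 : σ.reg 0 ≤ B) (h1 : σ.reg 1 ≤ B) :
    ∃ τ t, Exec (e.compile x) σ τ t ∧ t ≤ e.cost B ∧ τ.mem = σ.mem ∧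
      τ.reg x = e.eval σ.reg σ.mem ∧ ∀ y < x, τ.reg y = σ.reg y := by
  induction e generalizing x σ with
  | lit k =>
    refine ⟨_, _, .const σ x k, le_rfl, rfl, by simp [State.setReg, eval], fun y hy => ?_⟩
    simp [State.setReg, hy.ne]
  | reg i =>
    refine ⟨_, _, .copy σ x i, le_rfl, rfl, by simp [State.setReg, eval], fun y hy => ?_⟩
    simp [State.setReg, hy.ne]
  | add e f ihe ihf =>
    obtain ⟨τ, t, E, ht, hm, hv, hr⟩ := ihe he.1 hx σ h0 h1
    obtain ⟨τ', t', E', ht', hm', hv', hr'⟩ := ihf he.2 (x := x + 1) (by omega) τ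
      (by rwa [hr 0 (by omega)]) (by rwa [hr 1 (by omega)])
    have hc := eval_congr he.2 σ.mem fun y (hy : y < K) => hr y (by omega)
    refine ⟨_, _, .seq E (.seq E' (.add τ' x x (x + 1))), by simp only [cost]; omega,
      hm'.trans hm, ?_, fun y hy => ?_⟩
    · simp [State.setReg, eval, hv', hr' x (by omega), hv, hm, hc]
    · simp [State.setReg, hy.ne, hr' y (by omega), hr y hy]
  | sub e f ihe ihf =>
    obtain ⟨τ, t, E, ht, hm, hv, hr⟩ := ihe he.1 hx σ h0 h1
    obtain ⟨τ', t', E', ht', hm', hv', hr'⟩ := ihf he.2 (x := x + 1) (by omega) τ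
      (by rwa [hr 0 (by omega)]) (by rwa [hr 1 (by omega)])
    have hc := eval_congr he.2 σ.mem fun y (hy : y < K) => hr y (by omega)
    refine ⟨_, _, .seq E (.seq E' (.sub τ' x x (x + 1))), by simp only [cost]; omega,
      hm'.trans hm, ?_, fun y hy => ?_⟩
    · simp [State.setReg, eval, hv', hr' x (by omega), hv, hm, hc]
    · simp [State.setReg, hy.ne, hr' y (by omega), hr y hy]
  | load e ih =>
    obtain ⟨τ, t, E, ht, hm, hv, hr⟩ := ih he hx σ h0 h1
    refine ⟨_, _, .seq E (.load τ x x), by simp only [cost]; omega, hm, ?_, fun y hy => ?_⟩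
    · simp [State.setReg, hv, hm, eval]
    · simp [State.setReg, hy.ne, hr y hy]
  | ite e f g ihe ihf ihg =>
    obtain ⟨τ, t, E, ht, hm, hv, hr⟩ := ihe he.1 hx σ h0 h1
    have h0' : τ.reg 0 ≤ B := by rwa [hr 0 (by omega)]
    have h1' : τ.reg 1 ≤ B := by rwa [hr 1 (by omega)]
    by_cases hz : τ.reg x = 0
    · obtain ⟨τ', t', E', ht', hm', hv', hr'⟩ := ihg he.2.2 hx τ h0' h1'
      have hc := eval_congr he.2.2 σ.mem fun y (hy : y < K) => hr y (by omega)
      refine ⟨_, _, .seq E (.ite_false hz E'), by simp only [cost]; omega,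
        hm'.trans hm, ?_, fun y hy => (hr' y hy).trans (hr y hy)⟩
      rw [hv', hm, hc, eval, if_neg (not_not.2 (hv ▸ hz))]
    · obtain ⟨τ', t', E', ht', hm', hv', hr'⟩ := ihf he.2.1 hx τ h0' h1'
      have hc := eval_congr he.2.1 σ.mem fun y (hy : y < K) => hr y (by omega)
      refine ⟨_, _, .seq E (.ite_true hz E'), by simp only [cost]; omega,
        hm'.trans hm, ?_, fun y hy => (hr' y hy).trans (hr y hy)⟩
      rw [hv', hm, hc, eval, if_pos (hv ▸ hz)]
  | sum i b e ih =>
    obtain ⟨h2, hi, hb, he⟩ := he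
    have hbB : σ.reg b ≤ B := by interval_cases b <;> assumption
    -- The register `x` accumulates the sum, `x + 1` counts down, and `x + 2` saves the old content
    -- of `i`. The four extra steps per pass are the addition to `x`, the constant one, and the two
    -- counter updates.
    obtain ⟨τ, t, E, ht, hτ⟩ := exec_loop (z := x + 1) (N := σ.reg b) (T := e.cost B + 4)
      (c := .seq (e.compile (x + 3)) (.seq (.add x x (x + 3))
        (.seq (.const (x + 3) 1) (.seq (.add i i (x + 3)) (.sub (x + 1) (x + 1) (x + 3))))))
      (fun k ω => ω.mem = σ.mem ∧ ω.reg (x + 1) = σ.reg b - k ∧ ω.reg (x + 2) = σ.reg i ∧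
        ω.reg i = k ∧ (∀ y < x, y ≠ i → ω.reg y = σ.reg y) ∧
        ω.reg x = ∑ k ∈ Finset.range k, e.eval (Function.update σ.reg i k) σ.mem)
      (fun k ω h => h.2.1)
      (by
        rintro k ω hk ⟨hm, hz, hs, hik, hr, hv⟩
        obtain ⟨τ, t, E, ht, hm', hv', hr'⟩ := ih he (x := x + 3) (by omega) ω
          (by rwa [hr 0 (by omega) (by omega)]) (by rwa [hr 1 (by omega) (by omega)])
        have hc := eval_congr he (ρ := ω.reg) (ρ' := Function.update σ.reg i k) σ.mem
          fun y (hy : y < K) => by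
            by_cases hyi : y = i
            · subst hyi; simp [hik]
            · simp [hyi, hr y (by omega) hyi]
        refine ⟨_, _, .seq E (.seq (.add ..) (.seq (.const ..) (.seq (.add ..) (.sub ..)))),
          by omega, hm'.trans hm, ?_, ?_, ?_, fun y hy hyi => ?_, ?_⟩
        · have e1 : x + 1 ≠ i := by omega
          have e2 : x + 3 ≠ i := by omega
          simp [State.setReg, hr' (x + 1) (by omega), hz, e1, e2]
          omega
        · have : x + 2 ≠ i := by omega
          simp [State.setReg, hr' (x + 2) (by omega), hs, this]
        · have e1 : i ≠ x := by omega
          have e2 : i ≠ x + 1 := by omega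
          have e3 : i ≠ x + 3 := by omega
          simp [State.setReg, hr' i (by omega), hik, e1, e2, e3]
        · have e1 : y ≠ x := by omega
          have e2 : y ≠ x + 1 := by omega
          have e3 : y ≠ x + 3 := by omega
          simp [State.setReg, hr' y (by omega), hr y hy hyi, hyi, e1, e2, e3]
        · have e1 : x ≠ i := by omega
          rw [Finset.sum_range_succ, ← hc, ← hv]
          simp [State.setReg, hr' x (by omega), hv', hm, e1])
      (Nat.zero_le _)
      (σ := (((σ.setReg x 0).setReg (x + 1) (σ.reg b)).setReg (x + 2) (σ.reg i)).setReg i 0)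
      (by
        refine ⟨rfl, ?_, ?_, ?_, fun y hy hyi => ?_, ?_⟩
        · have e1 : x + 1 ≠ i := by omega
          simp [State.setReg, e1]
        · have e1 : x + 2 ≠ i := by omega
          simp [State.setReg, e1]
        · simp [State.setReg]
        · have e1 : y ≠ x := by omega
          have e2 : y ≠ x + 1 := by omega
          have e3 : y ≠ x + 2 := by omega
          simp [State.setReg, e1, e2, e3, hyi]
        · have e1 : x ≠ i := by omega
          simp [State.setReg, e1])
    obtain ⟨hm, -, hs, -, hr, hv⟩ := hτ
    have e1 : b ≠ x := by omega
    have e2 : i ≠ x := by omega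
    have e3 : i ≠ x + 1 := by omega
    have E0 := Exec.seq (.const σ x 0) (.seq (.copy _ (x + 1) b) (.seq (.copy _ (x + 2) i)
      (.seq (.const _ i 0) (.seq (d := .copy i (x + 2)) (ρ := τ.setReg i (τ.reg (x + 2))) (u := 1)
        (by simpa [State.setReg, e1, e2, e3] using E) (.copy _ _ _)))))
    refine ⟨_, _, E0, ?_, hm, ?_, fun y hy => ?_⟩
    · have := Nat.mul_le_mul_right (e.cost B + 5) hbB
      change t ≤ σ.reg b * (e.cost B + 5) + 1 at ht
      simp only [cost]
      omega
    · simp [State.setReg, e2.symm, hv, eval]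
    · by_cases hyi : y = i
      · subst hyi; simp [State.setReg, hs]
      · simp [State.setReg, hyi, hr y hy hyi]

end Expr

/-- Programs that store values in memory, with bounded loops. In `loop i b s` the register `i` runs
through the numbers below the content of the register `b`. -/
inductive Stmt : Type
  | store (a v : Expr)
  | seq (s s' : Stmt)
  | loop (i b : ℕ) (s : Stmt)

namespace Stmt

/-- The effect on the memory. -/
def run : Stmt → (ℕ → ℕ) → (ℕ → ℕ) → ℕ → ℕ
  | store a v, ρ, μ => Function.update μ (a.eval ρ μ) (v.eval ρ μ)
  | seq s s', ρ, μ => s'.run ρ (s.run ρ μ)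
  | loop i b s, ρ, μ =>
    Nat.rec (motive := fun _ => ℕ → ℕ) μ (fun k μ' => s.run (Function.update ρ i k) μ') (ρ b)

/-- As `Expr.WF`. -/
def WF (K : ℕ) : Stmt → Prop
  | store a v => a.WF K ∧ v.WF K
  | seq s s' => s.WF K ∧ s'.WF K
  | loop i b s => 2 ≤ i ∧ i < K ∧ b < 2 ∧ s.WF K

/-- Translation to machine programs, with auxiliary registers from `x` on. -/
def compile : Stmt → ℕ → Cmd
  | store a v, x => .seq (a.compile x) (.seq (v.compile (x + 1)) (.store x (x + 1)))
  | seq s s', x => .seq (s.compile x) (s'.compile x)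
  | loop i b s, x =>
    .seq (.copy x b) (.seq (.copy (x + 1) i) (.seq (.const i 0)
      (.seq (.loop x (.seq (s.compile (x + 2)) (.seq (.const (x + 2) 1)
        (.seq (.add i i (x + 2)) (.sub x x (x + 2)))))) (.copy i (x + 1)))))

/-- A bound for the running time, if all loops are bounded by `B`. -/
def cost (B : ℕ) : Stmt → ℕ
  | store a v => a.cost B + v.cost B + 1
  | seq s s' => s.cost B + s'.cost B
  | loop _ _ s => B * (s.cost B + 4) + 5

theorem polyBounded_cost (s : Stmt) : PolyBounded fun B => s.cost B := by
  induction s with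
  | store a v => exact (a.polyBounded_cost.add v.polyBounded_cost).add (.const 1)
  | seq s s' h h' => exact h.add h'
  | loop i b s h => exact (PolyBounded.id.mul (h.add (.const 4))).add (.const 5)

theorem run_congr {K : ℕ} {s : Stmt} (hs : s.WF K) {ρ ρ' : ℕ → ℕ} (μ : ℕ → ℕ)
    (h : ∀ y < K, ρ y = ρ' y) : s.run ρ μ = s.run ρ' μ := by
  induction s generalizing ρ ρ' μ with
  | store a v => simp only [run, a.eval_congr hs.1 μ h, v.eval_congr hs.2 μ h]
  | seq s s' ih ih' => simp only [run, ih hs.1 _ h, ih' hs.2 _ h]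
  | loop i b s ih =>
    obtain ⟨h2, hi, hb, hs⟩ := hs
    simp only [run, h b (by omega)]
    congr 1
    funext k μ'
    refine ih hs μ' fun y hy => ?_
    simp only [Function.update_apply, h y hy]

theorem exec_compile {K B : ℕ} (hK : 2 ≤ K) (s : Stmt) (hs : s.WF K) {x : ℕ} (hx : K ≤ x)
    (σ : State) (h0 : σ.reg 0 ≤ B) (h1 : σ.reg 1 ≤ B) :
    ∃ τ t, Exec (s.compile x) σ τ t ∧ t ≤ s.cost B ∧ τ.mem = s.run σ.reg σ.mem ∧
      ∀ y < x, τ.reg y = σ.reg y := by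
  induction s generalizing x σ with
  | store a v =>
    obtain ⟨τ, t, E, ht, hm, hv, hr⟩ := a.exec_compile hK hs.1 hx σ h0 h1
    obtain ⟨τ', t', E', ht', hm', hv', hr'⟩ := v.exec_compile (B := B) hK hs.2 (x := x + 1) (by omega) τ
      (by rwa [hr 0 (by omega)]) (by rwa [hr 1 (by omega)])
    have hc := v.eval_congr hs.2 σ.mem fun y (hy : y < K) => hr y (by omega)
    refine ⟨_, _, .seq E (.seq E' (.store τ' x (x + 1))), by simp only [cost]; omega, ?_,
      fun y hy => (hr' y (by omega)).trans (hr y hy)⟩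
    simp [State.setMem, run, hv', hr' x (by omega), hv, hm', hm, hc]
  | seq s s' ih ih' =>
    obtain ⟨τ, t, E, ht, hm, hr⟩ := ih hs.1 hx σ h0 h1
    obtain ⟨τ', t', E', ht', hm', hr'⟩ := ih' hs.2 hx τ
      (by rwa [hr 0 (by omega)]) (by rwa [hr 1 (by omega)])
    refine ⟨_, _, .seq E E', by simp only [cost]; omega, ?_,
      fun y hy => (hr' y hy).trans (hr y hy)⟩
    rw [hm', hm, run]
    exact run_congr hs.2 _ fun y hy => hr y (by omega)
  | loop i b s ih =>
    obtain ⟨h2, hi, hb, hs⟩ := hs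
    have hbB : σ.reg b ≤ B := by interval_cases b <;> assumption
    obtain ⟨τ, t, E, ht, hτ⟩ := exec_loop (z := x) (N := σ.reg b) (T := s.cost B + 3)
      (c := .seq (s.compile (x + 2)) (.seq (.const (x + 2) 1)
        (.seq (.add i i (x + 2)) (.sub x x (x + 2)))))
      (fun k ω => ω.reg x = σ.reg b - k ∧ ω.reg (x + 1) = σ.reg i ∧
        ω.reg i = k ∧ (∀ y < x, y ≠ i → ω.reg y = σ.reg y) ∧
        ω.mem = Nat.rec (motive := fun _ => ℕ → ℕ) σ.mem
          (fun k μ' => s.run (Function.update σ.reg i k) μ') k)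
      (fun k ω h => h.1)
      (by
        rintro k ω hk ⟨hz, hs', hik, hr, hm⟩
        obtain ⟨τ, t, E, ht, hm', hr'⟩ := ih hs (x := x + 2) (by omega) ω
          (by rwa [hr 0 (by omega) (by omega)]) (by rwa [hr 1 (by omega) (by omega)])
        have hc := run_congr hs (ρ := ω.reg) (ρ' := Function.update σ.reg i k) ω.mem
          fun y (hy : y < K) => by
            by_cases hyi : y = i
            · subst hyi; simp [hik]
            · simp [hyi, hr y (by omega) hyi]
        refine ⟨_, _, .seq E (.seq (.const ..) (.seq (.add ..) (.sub ..))),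
          by omega, ?_, ?_, ?_, fun y hy hyi => ?_, ?_⟩
        · have e1 : x ≠ i := by omega
          have e2 : x + 2 ≠ i := by omega
          simp [State.setReg, hr' x (by omega), hz, e1, e2]
          omega
        · have : x + 1 ≠ i := by omega
          simp [State.setReg, hr' (x + 1) (by omega), hs', this]
        · have e1 : i ≠ x := by omega
          have e3 : i ≠ x + 2 := by omega
          simp [State.setReg, hr' i (by omega), hik, e1, e3]
        · have e1 : y ≠ x := by omega
          have e3 : y ≠ x + 2 := by omega
          simp [State.setReg, hr' y (by omega), hr y hy hyi, hyi, e1, e3]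
        · exact hm'.trans (hc.trans (by rw [hm])))
      (Nat.zero_le _)
      (σ := ((σ.setReg x (σ.reg b)).setReg (x + 1) (σ.reg i)).setReg i 0)
      (by
        refine ⟨?_, ?_, ?_, fun y hy hyi => ?_, rfl⟩
        · have e1 : x ≠ i := by omega
          simp [State.setReg, e1]
        · have e1 : x + 1 ≠ i := by omega
          simp [State.setReg, e1]
        · simp [State.setReg]
        · have e1 : y ≠ x := by omega
          have e2 : y ≠ x + 1 := by omega
          simp [State.setReg, e1, e2, hyi])
    obtain ⟨-, hs', -, hr, hm⟩ := hτ
    have e2 : i ≠ x := by omega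
    have E0 := Exec.seq (.copy σ x b) (.seq (.copy _ (x + 1) i)
      (.seq (.const _ i 0) (.seq (d := .copy i (x + 1)) (ρ := τ.setReg i (τ.reg (x + 1))) (u := 1)
        (by simpa [State.setReg, e2] using E) (.copy _ _ _))))
    refine ⟨_, _, E0, ?_, hm, fun y hy => ?_⟩
    · have := Nat.mul_le_mul_right (s.cost B + 4) hbB
      change t ≤ σ.reg b * (s.cost B + 4) + 1 at ht
      simp only [cost]
      omega
    · by_cases hyi : y = i
      · subst hyi; simp [State.setReg, hs']
      · simp [State.setReg, hyi, hr y hy hyi]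

end Stmt

end RAM

/-! ### Invariants for bounded loops -/

namespace RAM

theorem Stmt.run_loop_induct {i b : ℕ} {s : Stmt} {ρ μ : ℕ → ℕ} (Inv : ℕ → (ℕ → ℕ) → Prop)
    (h0 : Inv 0 μ)
    (hstep : ∀ k < ρ b, ∀ μ', Inv k μ' → Inv (k + 1) (s.run (Function.update ρ i k) μ')) :
    Inv (ρ b) ((Stmt.loop i b s).run ρ μ) := by
  have : ∀ k ≤ ρ b, Inv k (Nat.rec (motive := fun _ => ℕ → ℕ) μ
      (fun k μ' => s.run (Function.update ρ i k) μ') k) := by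
    intro k
    induction k with
    | zero => exact fun _ => h0
    | succ k ih => exact fun hk => hstep k hk _ (ih (by omega))
  exact this _ le_rfl

/-- Filling a table with the rows `0, …, m - 1` and the columns `0, …, n - 1`. -/
theorem Stmt.run_fill {m n base i j : ℕ} {a v : Expr} {ρ μ : ℕ → ℕ} (h0 : ρ 0 = m) (h1 : ρ 1 = n)
    (hi : i ≠ 1) (g : ℕ → ℕ → ℕ)
    (ha : ∀ d s μ', a.eval (Function.update (Function.update ρ i d) j s) μ' = base + n * d + s)
    (hv : ∀ d < m, ∀ s < n, ∀ μ', (∀ x, x < base ∨ base + m * n ≤ x → μ' x = μ x) →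
      v.eval (Function.update (Function.update ρ i d) j s) μ' = g d s) :
    (∀ x, x < base ∨ base + m * n ≤ x →
        (Stmt.loop i 0 (.loop j 1 (.store a v))).run ρ μ x = μ x) ∧
      ∀ d < m, ∀ s < n,
        (Stmt.loop i 0 (.loop j 1 (.store a v))).run ρ μ (base + n * d + s) = g d s := by
  rw [← h0]
  refine Stmt.run_loop_induct (fun k μ' => (∀ x, x < base ∨ base + ρ 0 * n ≤ x → μ' x = μ x) ∧
    ∀ d < k, ∀ s < n, μ' (base + n * d + s) = g d s) ⟨fun _ _ => rfl, by simp⟩ ?_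
  rintro k hk μ₁ ⟨hout, hin⟩
  have hn : Function.update ρ i k 1 = n := by simp [hi.symm, h1]
  have := Stmt.run_loop_induct (i := j) (b := 1) (s := .store a v) (ρ := Function.update ρ i k)
    (μ := μ₁) (fun l μ' => (∀ x, x < base ∨ base + ρ 0 * n ≤ x → μ' x = μ x) ∧
      (∀ d < k, ∀ s < n, μ' (base + n * d + s) = g d s) ∧
      ∀ s < l, μ' (base + n * k + s) = g k s) ⟨hout, hin, by simp⟩ (by
    rintro l hl μ₂ ⟨hout, hin, hrow⟩
    rw [hn] at hl
    -- Row `k` ends within the table, so writing to it leaves the cells outside unchanged.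
    have hmul : n * (k + 1) ≤ n * ρ 0 := Nat.mul_le_mul_left _ hk
    rw [Nat.mul_comm n (ρ 0), Nat.mul_succ] at hmul
    rw [Stmt.run, ha, hv k (h0 ▸ hk) l hl μ₂ (h0 ▸ hout)]
    refine ⟨fun x hx => ?_, fun d hd s hs => ?_, fun s hs => ?_⟩
    · rw [Function.update_of_ne (by omega), hout x hx]
    · have : n * (d + 1) ≤ n * k := Nat.mul_le_mul_left _ hd
      rw [Nat.mul_succ] at this
      rw [Function.update_of_ne (by omega), hin d hd s hs]
    · by_cases hsl : s = l
      · subst hsl; simp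
      · rw [Function.update_of_ne (by omega), hrow s (by omega)])
  rw [hn] at this
  obtain ⟨hout', hin', hrow'⟩ := this
  refine ⟨hout', fun d hd s hs => ?_⟩
  by_cases hdk : d = k
  · subst hdk; exact hrow' s hs
  · exact hin' d (by omega) s hs

end RAM

namespace ManipulationProgram

open RAM Market

/-! ### Expressions -/

/-- The product of the registers `a` and `j`, where `a` is `0` or `1`. -/
def mulE (a j : ℕ) : Expr := .sum 2 a (.reg j)

/-- The test for equality. -/
def eqE (e f : Expr) : Expr := .sub (.lit 1) (.add (.sub e f) (.sub f e))

/-- The address of the entry `k` of the list of the college `d`. -/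
def collegeAddr (d k : ℕ) : Expr :=
  .add (.add (.add (.lit 3) (.reg 0)) (mulE 1 d)) (.reg k)

/-- The address of the entry `k` of the list of the student `s`. -/
def studentAddr (s k : ℕ) : Expr :=
  .add (.add (.add (.add (.lit 3) (.reg 0)) (mulE 0 1)) (mulE 0 s)) (.reg k)

/-- The first address after the input. -/
def baseE : Expr := .add (.add (.add (.lit 3) (.reg 0)) (mulE 0 1)) (mulE 0 1)

/-- The address of the bit that tells if `s` survives. -/
def survivorAddr (s : Expr) : Expr := .add baseE s

/-- The address of the bit that tells if `d` made an offer to `s`. -/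
def offerAddr (d s : ℕ) : Expr := .add (.add (.add baseE (.reg 1)) (mulE 1 d)) (.reg s)

/-- The address of the bit that tells if `d` makes an offer to `s` in the next step. -/
def nextAddr (d s : ℕ) : Expr :=
  .add (.add (.add (.add baseE (.reg 1)) (mulE 0 1)) (mulE 1 d)) (.reg s)

/-- The position of `d` in the list of the student `s`. -/
def rankE (s d : ℕ) : Expr :=
  .sum 3 0 (.ite (eqE (.load (studentAddr s 3)) (.reg d)) (.reg 3) (.lit 0))

/-- The position of `s` in the list of the college `d`. -/
def posE (d s : ℕ) : Expr :=
  .sum 3 1 (.ite (eqE (.load (collegeAddr d 3)) (.reg s)) (.reg 3) (.lit 0))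

/-- The test if `s` has an offer that is preferred to `d`. -/
def rejectsE (d s : ℕ) : Expr :=
  .sum 4 0 (.ite (.load (offerAddr 4 s)) (.sub (rankE s d) (rankE s 4)) (.lit 0))

/-- The number of students who reject `d`. -/
def rejectersE (d : ℕ) : Expr :=
  .sum 5 1 (.ite (.load (offerAddr d 5)) (.ite (rejectsE d 5) (.lit 1) (.lit 0)) (.lit 0))

/-- The test if `d` makes an offer to `s` in the next step. -/
def stepE (d s : ℕ) : Expr :=
  .ite (eqE (.reg d) (.load (.lit 2))) (.load (survivorAddr (.reg s)))
    (.ite (.sub (.add (.load (.add (.lit 3) (.reg d))) (rejectersE d)) (posE d s)) (.lit 1)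
      (.lit 0))

/-- The number of students whom the manipulating college gets. -/
def chosenE : Expr :=
  .sum 6 0 (.ite (eqE (.reg 6) (.load (.lit 2)))
    (.sum 7 1 (.ite (.load (survivorAddr (.reg 7))) (.ite (rejectsE 6 7) (.lit 0) (.lit 1))
      (.lit 0))) (.lit 0))

/-- The student to be deleted in the round given by the register `8`. -/
def candidateE : Expr :=
  .load (.add (.add (.add (.lit 3) (.reg 0)) (.sum 2 1 (.load (.lit 2))))
    (.sub (.sub (.reg 1) (.lit 1)) (.reg 8)))

/-- The key by which the students are sorted in the report. -/
def keyE (s : ℕ) : Expr :=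
  .add (.ite (.load (survivorAddr (.reg s))) (.lit 0) (.reg 1)) (.reg s)

/-- The position of `s` in the report. -/
def reportPosE (s : ℕ) : Expr :=
  .sum 4 1 (.ite (.sub (keyE s) (keyE 4)) (.lit 1) (.lit 0))

/-- The student at the position `k` of the report. -/
def reportE (k : ℕ) : Expr :=
  .sum 5 1 (.ite (eqE (reportPosE 5) (.reg k)) (.reg 5) (.lit 0))

/-! ### The program -/

/-- All students survive at the beginning. -/
def initS : Stmt := .loop 6 1 (.store (survivorAddr (.reg 6)) (.lit 1))

/-- No offers have been made. -/
def clearS : Stmt := .loop 6 0 (.loop 7 1 (.store (offerAddr 6 7) (.lit 0)))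

/-- One step of the iteration that computes all offers. -/
def stepS : Stmt :=
  .seq (.loop 6 0 (.loop 7 1 (.store (nextAddr 6 7) (stepE 6 7))))
    (.loop 6 0 (.loop 7 1 (.store (offerAddr 6 7) (.load (nextAddr 6 7)))))

/-- The computation of all offers. -/
def offersS : Stmt := .seq clearS (.loop 9 0 (.loop 10 1 stepS))

/-- One attempt to delete a student. -/
def deleteS : Stmt :=
  .seq (.store (survivorAddr candidateE) (.lit 0)) (.seq offersS
    (.store (survivorAddr candidateE)
      (.ite (.sub (.load (.add (.lit 3) (.load (.lit 2)))) chosenE) (.lit 1) (.lit 0))))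

/-- The output of the report. -/
def reportS : Stmt := .loop 6 1 (.store (.reg 6) (reportE 6))

/-- The computation of an optimal manipulation. -/
def mainS : Stmt := .seq initS (.seq (.loop 8 1 deleteS) reportS)

theorem mainS_wf : mainS.WF 11 := by
  simp [mainS, initS, deleteS, reportS, offersS, stepS, clearS, Stmt.WF, Expr.WF, reportE,
    reportPosE, keyE, candidateE, chosenE, stepE, rejectersE, rejectsE, posE, rankE, nextAddr,
    offerAddr, survivorAddr, baseE, studentAddr, collegeAddr, eqE, mulE]

variable {m n : ℕ}

/-- The first address after the input. -/
def base (m n : ℕ) : ℕ := 3 + m + m * n + m * n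

/-! ### Values of the expressions -/

/-- The memory contains the instance. -/
structure HasInput (M : Market m n) (c : Fin m) (μ : ℕ → ℕ) : Prop where
  college : μ 2 = c
  capacity : ∀ d : Fin m, μ (3 + d) = M.q d
  collegeList : ∀ (d : Fin m) (k : Fin n), μ (3 + m + n * d + k) = (M.collegeList d k : Fin n)
  studentList : ∀ (s : Fin n) (k : Fin m),
    μ (3 + m + m * n + m * s + k) = (M.studentList s k : Fin m)

theorem mul_add_lt {a b : ℕ} (i : Fin a) (j : Fin b) : b * i + j < a * b := by
  have : b * (i + 1) ≤ b * a := Nat.mul_le_mul_left _ i.isLt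
  rw [Nat.mul_succ, Nat.mul_comm b a] at this
  have := j.isLt
  omega

theorem HasInput.congr {M : Market m n} {c : Fin m} {μ μ' : ℕ → ℕ} (h : HasInput M c μ)
    (hμ : ∀ x < base m n, μ' x = μ x) : HasInput M c μ' where
  college := by rw [hμ _ (by have := c.isLt; unfold base; omega), h.college]
  capacity d := by rw [hμ _ (by have := d.isLt; unfold base; omega), h.capacity]
  collegeList d k := by
    rw [hμ _ (by have := mul_add_lt d k; unfold base; omega), h.collegeList]
  studentList s k := by
    rw [hμ _ (by have := mul_add_lt s k; have := Nat.mul_comm m n; unfold base; omega),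
      h.studentList]

/-- The memory contains the set `Y` of survivors. -/
def HasSurvivors (Y : Finset (Fin n)) (m : ℕ) (μ : ℕ → ℕ) : Prop :=
  ∀ s : Fin n, μ (base m n + s) = if s ∈ Y then 1 else 0

/-- The memory contains the offers `O`. -/
def HasOffers (O : Fin m → Finset (Fin n)) (μ : ℕ → ℕ) : Prop :=
  ∀ (d : Fin m) (s : Fin n), μ (base m n + n + n * d + s) = if s ∈ O d then 1 else 0

theorem eval_eqE (e f : Expr) (ρ μ : ℕ → ℕ) :
    (eqE e f).eval ρ μ = if e.eval ρ μ = f.eval ρ μ then 1 else 0 := by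
  simp only [eqE, Expr.eval]
  split_ifs <;> omega

theorem eval_mulE {a j : ℕ} (hj : j ≠ 2) (ρ μ : ℕ → ℕ) :
    (mulE a j).eval ρ μ = ρ a * ρ j := by
  simp [mulE, Expr.eval, hj]

theorem eval_baseE {ρ : ℕ → ℕ} (h0 : ρ 0 = m) (h1 : ρ 1 = n) (μ : ℕ → ℕ) :
    baseE.eval ρ μ = base m n := by
  simp [baseE, Expr.eval, eval_mulE, h0, h1, base]

theorem eval_survivorAddr {ρ : ℕ → ℕ} (h0 : ρ 0 = m) (h1 : ρ 1 = n) (μ : ℕ → ℕ) (e : Expr) :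
    (survivorAddr e).eval ρ μ = base m n + e.eval ρ μ := by
  simp [survivorAddr, Expr.eval, eval_baseE h0 h1]

theorem eval_offerAddr {ρ : ℕ → ℕ} (h0 : ρ 0 = m) (h1 : ρ 1 = n) (μ : ℕ → ℕ) {d s : ℕ}
    (hd : d ≠ 2) : (offerAddr d s).eval ρ μ = base m n + n + n * ρ d + ρ s := by
  simp [offerAddr, Expr.eval, eval_baseE h0 h1, eval_mulE hd, h1]

theorem eval_nextAddr {ρ : ℕ → ℕ} (h0 : ρ 0 = m) (h1 : ρ 1 = n) (μ : ℕ → ℕ) {d s : ℕ}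
    (hd : d ≠ 2) : (nextAddr d s).eval ρ μ = base m n + n + m * n + n * ρ d + ρ s := by
  simp [nextAddr, Expr.eval, eval_baseE h0 h1, eval_mulE, hd, h1, h0]

/-- The program inverts a preference list by a sum with only one possibly nonzero term. -/
theorem sum_ite_perm_eq {k : ℕ} (l : Equiv.Perm (Fin k)) (a : Fin k) :
    ∑ i : Fin k, (if ((l i : Fin k) : ℕ) = a then (i : ℕ) else 0) = (l.symm a : ℕ) := by
  rw [Finset.sum_eq_single (l.symm a)]
  · simp
  · intro i _ hi
    rw [if_neg]
    intro h
    exact hi ((Equiv.eq_symm_apply l).2 (Fin.ext h))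
  · simp

section Eval

variable {M : Market m n} {c : Fin m} {Y : Finset (Fin n)} {O : Fin m → Finset (Fin n)}
  {ρ μ : ℕ → ℕ}

/-- The inequalities between register names keep the arguments clear of the summation registers used
inside the expression; the same holds for the evaluations below. -/
theorem eval_rankE (hI : HasInput M c μ) (h0 : ρ 0 = m) (h1 : ρ 1 = n) {d s : ℕ} {d' : Fin m}
    {s' : Fin n} (hd : ρ d = d') (hs : ρ s = s') (hd3 : d ≠ 3) (hs2 : s ≠ 2) (hs3 : s ≠ 3) :
    (rankE s d).eval ρ μ = ((M.studentList s').symm d' : ℕ) := by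
  rw [← sum_ite_perm_eq]
  simp only [rankE, Expr.eval, h0, Finset.sum_range, eval_eqE, studentAddr]
  refine Finset.sum_congr rfl fun k _ => ?_
  simp [eval_mulE hs2, eval_mulE, h0, h1, hs, hd, hs3, hd3, hI.studentList]

theorem eval_posE (hI : HasInput M c μ) (h0 : ρ 0 = m) (h1 : ρ 1 = n) {d s : ℕ} {d' : Fin m}
    {s' : Fin n} (hd : ρ d = d') (hs : ρ s = s') (hd2 : d ≠ 2) (hd3 : d ≠ 3) (hs3 : s ≠ 3) :
    (posE d s).eval ρ μ = ((M.collegeList d').symm s' : ℕ) := by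
  rw [← sum_ite_perm_eq]
  simp only [posE, Expr.eval, h1, Finset.sum_range, eval_eqE, collegeAddr]
  refine Finset.sum_congr rfl fun k _ => ?_
  simp [eval_mulE hd2, h0, h1, hs, hd, hs3, hd3, hI.collegeList]

theorem mem_rejecters_iff {d : Fin m} {s : Fin n} : s ∈ M.rejecters O d ↔
    s ∈ O d ∧ ∃ d', s ∈ O d' ∧ (M.studentList s).symm d' < (M.studentList s).symm d := by
  rw [rejecters, Finset.mem_filter]
  refine and_congr_right fun hs => ⟨fun h => ?_, ?_⟩
  · by_contra! hc
    refine h ⟨hs, fun d' hd' => ?_⟩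
    rcases (hc d' hd').eq_or_lt with h | h
    · exact Or.inl ((M.studentList s).symm.injective h).symm
    · exact Or.inr h
  · rintro ⟨d', hd', hlt⟩ ⟨-, hk⟩
    rcases hk d' hd' with h | h
    · exact absurd (h ▸ hlt) (lt_irrefl _)
    · exact absurd hlt (not_lt.2 h.le)

/-- A truncated difference of ranks is nonzero exactly if the other offer is strictly preferred, so
the sum is nonzero exactly if such an offer exists. -/
theorem eval_rejectsE (hI : HasInput M c μ) (hO : HasOffers O μ) (h0 : ρ 0 = m) (h1 : ρ 1 = n)
    {d s : ℕ} {d' : Fin m} {s' : Fin n} (hd : ρ d = d') (hs : ρ s = s') (hd3 : d ≠ 3)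
    (hd4 : d ≠ 4) (hs2 : s ≠ 2) (hs3 : s ≠ 3) (hs4 : s ≠ 4) (hsO : s' ∈ O d') :
    (rejectsE d s).eval ρ μ ≠ 0 ↔ s' ∈ M.rejecters O d' := by
  have hterm : ∀ k : Fin m, (Expr.ite (.load (offerAddr 4 s)) (.sub (rankE s d) (rankE s 4))
      (.lit 0)).eval (Function.update ρ 4 k) μ =
      if s' ∈ O k then ((M.studentList s').symm d' : ℕ) - (M.studentList s').symm k else 0 := by
    intro k
    have h0' : Function.update ρ 4 (k : ℕ) 0 = m := by simp [h0]
    have h1' : Function.update ρ 4 (k : ℕ) 1 = n := by simp [h1]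
    simp only [Expr.eval, eval_offerAddr h0' h1' μ (show 4 ≠ 2 by decide),
      Function.update_self, Function.update_of_ne hs4, hs, hO k s',
      eval_rankE hI h0' h1' (d := d) (d' := d') (s' := s') (by simp [hd4, hd]) (by simp [hs4, hs])
        hd3 hs2 hs3,
      eval_rankE hI h0' h1' (d := 4) (d' := k) (s' := s') (by simp) (by simp [hs4, hs])
        (by decide) hs2 hs3]
    split_ifs <;> simp_all
  simp only [rejectsE]
  rw [Expr.eval, h0, Finset.sum_range, Finset.sum_congr rfl fun k _ => hterm k,
    mem_rejecters_iff, Ne, Finset.sum_eq_zero_iff]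
  simp only [hsO, true_and, Finset.mem_univ, true_imp_iff, not_forall, ite_eq_right_iff,
    exists_prop, Nat.sub_eq_zero_iff_le, not_le, Fin.lt_def]

theorem eval_rejectersE (hI : HasInput M c μ) (hO : HasOffers O μ) (h0 : ρ 0 = m) (h1 : ρ 1 = n)
    {d : ℕ} {d' : Fin m} (hd : ρ d = d') (hd2 : d ≠ 2) (hd3 : d ≠ 3) (hd4 : d ≠ 4) (hd5 : d ≠ 5) :
    (rejectersE d).eval ρ μ = (M.rejecters O d').card := by
  have hterm : ∀ k : Fin n, (Expr.ite (.load (offerAddr d 5)) (.ite (rejectsE d 5) (.lit 1)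
      (.lit 0)) (.lit 0)).eval (Function.update ρ 5 k) μ =
      if k ∈ M.rejecters O d' then 1 else 0 := by
    intro k
    have h0' : Function.update ρ 5 (k : ℕ) 0 = m := by simp [h0]
    have h1' : Function.update ρ 5 (k : ℕ) 1 = n := by simp [h1]
    simp only [Expr.eval, eval_offerAddr h0' h1' μ hd2, Function.update_self,
      Function.update_of_ne hd5, hd, hO d' k]
    by_cases hk : k ∈ O d'
    · simp only [hk, if_true, ne_eq, one_ne_zero, not_false_eq_true]
      exact if_congr (eval_rejectsE hI hO h0' h1' (by simp [hd5, hd]) (by simp) hd3 hd4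
        (by decide) (by decide) (by decide) hk) rfl rfl
    · have : k ∉ M.rejecters O d' := fun h => hk (M.rejecters_subset O d' h)
      simp [hk, this]
  simp only [rejectersE]
  rw [Expr.eval, h1, Finset.sum_range, Finset.sum_congr rfl fun k _ => hterm k]
  simp

theorem eval_stepE (hI : HasInput M c μ) (hY : HasSurvivors Y m μ) (hO : HasOffers O μ)
    (h0 : ρ 0 = m) (h1 : ρ 1 = n) {d s : ℕ} {d' : Fin m} {s' : Fin n} (hd : ρ d = d')
    (hs : ρ s = s') (hd2 : d ≠ 2) (hd3 : d ≠ 3) (hd4 : d ≠ 4) (hd5 : d ≠ 5) (hs3 : s ≠ 3) :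
    (stepE d s).eval ρ μ = if s' ∈ M.offerStep c Y O d' then 1 else 0 := by
  simp only [stepE, Expr.eval, eval_eqE, hI.college, hd, eval_survivorAddr h0 h1, hs, hY s',
    hI.capacity d', eval_rejectersE hI hO h0 h1 hd hd2 hd3 hd4 hd5,
    eval_posE hI h0 h1 hd hs hd2 hd3 hs3, offerStep, Fin.val_inj]
  by_cases h : d' = c
  · simp [h]
  · simp [h, fullStep, Nat.sub_eq_zero_iff_le]

theorem eval_chosenE (hI : HasInput M c μ) (hY : HasSurvivors Y m μ) (hO : HasOffers O μ)
    (h0 : ρ 0 = m) (h1 : ρ 1 = n) (hc : O c = Y) :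
    chosenE.eval ρ μ = (Y \ M.rejecters O c).card := by
  have hterm : ∀ (d : Fin m) (k : Fin n), (Expr.ite (.load (survivorAddr (.reg 7)))
      (.ite (rejectsE 6 7) (.lit 0) (.lit 1)) (.lit 0)).eval
        (Function.update (Function.update ρ 6 d) 7 k) μ =
      if k ∈ Y then if (rejectsE 6 7).eval (Function.update (Function.update ρ 6 d) 7 k) μ ≠ 0
        then 0 else 1 else 0 := by
    intro d k
    have h0' : Function.update (Function.update ρ 6 (d : ℕ)) 7 (k : ℕ) 0 = m := by simp [h0]
    have h1' : Function.update (Function.update ρ 6 (d : ℕ)) 7 (k : ℕ) 1 = n := by simp [h1]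
    simp only [Expr.eval, eval_survivorAddr h0' h1', Function.update_self, hY k]
    split_ifs <;> simp_all
  have hterm' : ∀ k : Fin n, (if k ∈ Y then
      if (rejectsE 6 7).eval (Function.update (Function.update ρ 6 c) 7 k) μ ≠ 0
        then 0 else 1 else 0) = if k ∈ Y \ M.rejecters O c then 1 else 0 := by
    intro k
    by_cases hk : k ∈ Y
    · rw [if_pos hk, if_congr (eval_rejectsE hI hO (by simp [h0]) (by simp [h1]) (d' := c)
        (s' := k) (by simp) (by simp) (by decide) (by decide) (by decide) (by decide) (by decide)
        (hc ▸ hk)) rfl rfl]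
      by_cases hr : k ∈ M.rejecters O c <;> simp [hk, hr]
    · simp [hk]
  simp only [chosenE]
  -- The outer sum only serves to put `c` into register `6`; all other terms vanish.
  rw [Expr.eval, h0, Finset.sum_range, Finset.sum_eq_single c]
  · have h1' : Function.update ρ 6 (c : ℕ) 1 = n := by simp [h1]
    rw [Expr.eval, eval_eqE, Expr.eval, Expr.eval, Expr.eval, Expr.eval, hI.college, Function.update_self,
      if_pos rfl, if_pos one_ne_zero, Expr.eval, h1', Finset.sum_range,
      Finset.sum_congr rfl fun k _ => (hterm c k).trans (hterm' k),
      Finset.sum_boole, Finset.filter_univ_mem, Nat.cast_id]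
  · intro d _ hd
    rw [Expr.eval, eval_eqE, Expr.eval, Expr.eval, Expr.eval, Expr.eval, hI.college, Function.update_self,
      if_neg fun h => hd (Fin.ext h), if_neg (not_not.2 rfl)]
  · simp

theorem eval_candidateE (hI : HasInput M c μ) (h0 : ρ 0 = m) (h1 : ρ 1 = n) {j : ℕ} (hj : ρ 8 = j)
    {s : Fin n} (hs : ((M.collegeList c).symm s : ℕ) + j + 1 = n) :
    candidateE.eval ρ μ = s := by
  have h := hI.collegeList c ((M.collegeList c).symm s)
  rw [Equiv.apply_symm_apply] at h
  have e : n - 1 - j = (M.collegeList c).symm s := by omega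
  simp only [candidateE, Expr.eval, h0, h1, hj, hI.college, Finset.sum_const, Finset.card_range,
    smul_eq_mul, e, h]

end Eval

/-! ### The report -/

/-- The key by which the students are sorted: the elements of `Y` first. -/
def reportKey (Y : Finset (Fin n)) (s : Fin n) : ℕ := (if s ∈ Y then 0 else n) + s

/-- The position of a student in the report. -/
def reportPos (Y : Finset (Fin n)) (s : Fin n) : ℕ :=
  (Finset.univ.filter fun t => reportKey Y t < reportKey Y s).card

theorem reportPos_lt_reportPos {Y : Finset (Fin n)} {s t : Fin n}
    (h : reportKey Y s < reportKey Y t) : reportPos Y s < reportPos Y t := by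
  refine Finset.card_lt_card ((Finset.ssubset_iff_of_subset ?_).2 ⟨s, by simpa, by simp⟩)
  intro r hr
  simp only [Finset.mem_filter, Finset.mem_univ, true_and] at *
  omega

theorem reportKey_injective (Y : Finset (Fin n)) : Function.Injective (reportKey Y) := by
  intro s t h
  have := s.isLt
  have := t.isLt
  simp only [reportKey] at h
  ext
  split_ifs at h <;> omega

theorem reportPos_lt (Y : Finset (Fin n)) (s : Fin n) : reportPos Y s < n := by
  have : reportPos Y s < (Finset.univ : Finset (Fin n)).card :=
    Finset.card_lt_card ((Finset.ssubset_iff_of_subset (Finset.filter_subset _ _)).2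
      ⟨s, Finset.mem_univ _, by simp⟩)
  simpa using this

/-- The report that begins with the elements of `Y`. -/
noncomputable def report (Y : Finset (Fin n)) : Equiv.Perm (Fin n) :=
  (Equiv.ofBijective (fun s => (⟨reportPos Y s, reportPos_lt Y s⟩ : Fin n))
    (Finite.injective_iff_bijective.1 fun s t h => by
      have h := Fin.val_eq_of_eq h
      simp only at h
      by_contra hne
      rcases lt_or_gt_of_ne fun e => hne (reportKey_injective Y e) with hlt | hlt <;>
      · have := reportPos_lt_reportPos hlt
        omega)).symm

theorem report_symm_apply (Y : Finset (Fin n)) (s : Fin n) :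
    ((report Y).symm s : ℕ) = reportPos Y s := rfl

/-- Keys of elements of `Y` are below `n` and all others are at least `n`, so exactly the elements
of `Y` have fewer than `Y.card` predecessors. -/
theorem topStudents_report (Y : Finset (Fin n)) : topStudents (report Y) Y.card = Y := by
  ext s
  rw [mem_topStudents, report_symm_apply]
  have hkey : ∀ t, reportKey Y t < n ↔ t ∈ Y := by
    intro t
    have := t.isLt
    simp only [reportKey]
    split_ifs with h <;> simp [h]
  constructor
  · intro h
    by_contra hs
    refine absurd h (not_lt.2 (Finset.card_le_card fun t ht => ?_))
    rw [← hkey] at ht hs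
    simp only [Finset.mem_filter, Finset.mem_univ, true_and]
    omega
  · intro hs
    refine Finset.card_lt_card ((Finset.ssubset_iff_of_subset fun t ht => ?_).2
      ⟨s, hs, by simp⟩)
    rw [← hkey] at *
    simp only [Finset.mem_filter, Finset.mem_univ, true_and] at ht
    omega

theorem eval_keyE {Y : Finset (Fin n)} {ρ μ : ℕ → ℕ} (hY : HasSurvivors Y m μ) (h0 : ρ 0 = m)
    (h1 : ρ 1 = n) {s : ℕ} {s' : Fin n} (hs : ρ s = s') :
    (keyE s).eval ρ μ = reportKey Y s' := by
  simp only [keyE, Expr.eval, eval_survivorAddr h0 h1, hs, hY s', h1, reportKey]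
  by_cases h : s' ∈ Y <;> simp [h]

theorem eval_reportPosE {Y : Finset (Fin n)} {ρ μ : ℕ → ℕ} (hY : HasSurvivors Y m μ) (h0 : ρ 0 = m)
    (h1 : ρ 1 = n) {s : ℕ} {s' : Fin n} (hs : ρ s = s') (hs4 : s ≠ 4) :
    (reportPosE s).eval ρ μ = reportPos Y s' := by
  have hterm : ∀ k : Fin n, (Expr.ite (.sub (keyE s) (keyE 4)) (.lit 1) (.lit 0)).eval
      (Function.update ρ 4 k) μ = if reportKey Y k < reportKey Y s' then 1 else 0 := by
    intro k
    have h0' : Function.update ρ 4 (k : ℕ) 0 = m := by simp [h0]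
    have h1' : Function.update ρ 4 (k : ℕ) 1 = n := by simp [h1]
    simp only [Expr.eval, eval_keyE hY h0' h1' (s := s) (s' := s') (by simp [hs4, hs]),
      eval_keyE hY h0' h1' (s := 4) (s' := k) (by simp), ne_eq, Nat.sub_eq_zero_iff_le, not_le]
  simp only [reportPosE]
  rw [Expr.eval, h1, Finset.sum_range, Finset.sum_congr rfl fun k _ => hterm k]
  simp [reportPos]

theorem eval_reportE {Y : Finset (Fin n)} {ρ μ : ℕ → ℕ} (hY : HasSurvivors Y m μ) (h0 : ρ 0 = m)
    (h1 : ρ 1 = n) {k : ℕ} {k' : Fin n} (hk : ρ k = k') (hk5 : k ≠ 5) :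
    (reportE k).eval ρ μ = (report Y k' : Fin n) := by
  have h := sum_ite_perm_eq (report Y).symm k'
  rw [Equiv.symm_symm] at h
  rw [← h]
  simp only [reportE, Expr.eval, h1, Finset.sum_range, eval_eqE, report_symm_apply]
  refine Finset.sum_congr rfl fun s _ => ?_
  rw [eval_reportPosE hY (by simp [h0]) (by simp [h1]) (s := 5) (s' := s) (by simp) (by decide)]
  exact if_congr (by simp [hk5, hk]) (by simp) rfl

end ManipulationProgram

namespace ManipulationProgram

open RAM Market

variable {m n : ℕ}

/-! ### Correctness of the program -/

theorem HasSurvivors.congr {Y : Finset (Fin n)} {μ μ' : ℕ → ℕ} (h : HasSurvivors Y m μ)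
    (hμ : ∀ s : Fin n, μ' (base m n + s) = μ (base m n + s)) : HasSurvivors Y m μ' :=
  fun s => (hμ s).trans (h s)

theorem HasOffers.congr {O : Fin m → Finset (Fin n)} {μ μ' : ℕ → ℕ} (h : HasOffers O μ)
    (hμ : ∀ x < base m n + n + m * n, μ' x = μ x) : HasOffers O μ' :=
  fun d s => (hμ _ (by have := mul_add_lt d s; omega)).trans (h d s)

theorem HasSurvivors.update {Y : Finset (Fin n)} {μ : ℕ → ℕ} (h : HasSurvivors Y m μ) (s : Fin n)
    (P : Prop) [Decidable P] :
    HasSurvivors (if P then insert s Y else Y.erase s) m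
      (Function.update μ (base m n + s) (if P then 1 else 0)) := by
  intro t
  by_cases hts : t = s
  · subst hts
    by_cases hP : P <;> simp [hP]
  · have : base m n + (t : ℕ) ≠ base m n + s := fun e => hts (Fin.ext (by omega))
    rw [Function.update_of_ne this, h t]
    by_cases hP : P <;> simp [hP, hts]

section Run

variable {M : Market m n} {c : Fin m} {Y : Finset (Fin n)} {O : Fin m → Finset (Fin n)}
  {ρ μ : ℕ → ℕ}

theorem run_initS (h0 : ρ 0 = m) (h1 : ρ 1 = n) :
    (∀ x < base m n, initS.run ρ μ x = μ x) ∧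
      HasSurvivors (Finset.univ : Finset (Fin n)) m (initS.run ρ μ) := by
  have := Stmt.run_loop_induct (i := 6) (b := 1) (s := .store (survivorAddr (.reg 6)) (.lit 1))
    (ρ := ρ) (μ := μ) (fun k μ' => (∀ x < base m n, μ' x = μ x) ∧
      ∀ s < k, μ' (base m n + s) = 1) ⟨fun _ _ => rfl, by simp⟩ (by
    rintro k hk μ' ⟨hout, hin⟩
    have h0' : Function.update ρ 6 k 0 = m := by simp [h0]
    have h1' : Function.update ρ 6 k 1 = n := by simp [h1]
    simp only [Stmt.run, eval_survivorAddr h0' h1', Expr.eval, Function.update_self]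
    refine ⟨fun x hx => ?_, fun s hs => ?_⟩
    · rw [Function.update_of_ne (by omega), hout x hx]
    · by_cases hsk : s = k
      · subst hsk; simp
      · rw [Function.update_of_ne (by omega), hin s (by omega)])
  rw [h1] at this
  exact ⟨this.1, fun s => (this.2 s s.isLt).trans (by simp)⟩

theorem run_clearS (h0 : ρ 0 = m) (h1 : ρ 1 = n) :
    (∀ x < base m n + n, clearS.run ρ μ x = μ x) ∧
      HasOffers (⊥ : Fin m → Finset (Fin n)) (clearS.run ρ μ) := by
  have := Stmt.run_fill (i := 6) (j := 7) (a := offerAddr 6 7) (v := .lit 0) (μ := μ)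
    (base := base m n + n) h0 h1 (by decide) (fun _ _ => 0)
    (fun d s μ' => by
      rw [eval_offerAddr (m := m) (n := n) (by simp [h0]) (by simp [h1]) μ' (by decide)]
      simp)
    (fun d _ s _ μ' _ => rfl)
  exact ⟨fun x hx => this.1 x (Or.inl hx), fun d s =>
    (this.2 d d.isLt s s.isLt).trans (by simp)⟩

/-- The next offers go to a separate table and are copied afterwards, so every entry is computed
from the same old offers. -/
theorem run_stepS (hI : HasInput M c μ) (hY : HasSurvivors Y m μ) (hO : HasOffers O μ)
    (h0 : ρ 0 = m) (h1 : ρ 1 = n) :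
    (∀ x < base m n + n, stepS.run ρ μ x = μ x) ∧
      HasOffers (M.offerStep c Y O) (stepS.run ρ μ) := by
  -- The default value `0` outside the table is never used.
  set g : ℕ → ℕ → ℕ := fun d s => if h : d < m ∧ s < n then
    if (⟨s, h.2⟩ : Fin n) ∈ M.offerStep c Y O ⟨d, h.1⟩ then 1 else 0 else 0 with hg
  have hg' : ∀ (d : Fin m) (s : Fin n), g d s = if s ∈ M.offerStep c Y O d then 1 else 0 := by
    intro d s
    simp [hg]
  have r1 := Stmt.run_fill (i := 6) (j := 7) (a := nextAddr 6 7) (v := stepE 6 7) (μ := μ)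
    (base := base m n + n + m * n) h0 h1 (by decide) g
    (fun d s μ' => by
      rw [eval_nextAddr (m := m) (n := n) (by simp [h0]) (by simp [h1]) μ' (by decide)]
      simp)
    (fun d hd s hs μ' hμ => by
      rw [eval_stepE (d' := ⟨d, hd⟩) (s' := ⟨s, hs⟩) (hI.congr fun x hx => hμ x (by omega))
        (hY.congr fun t => hμ _ (by have := t.isLt; omega))
        (hO.congr fun x hx => hμ x (by omega))
        (by simp [h0]) (by simp [h1]) (by simp) (by simp) (by decide) (by decide) (by decide)
        (by decide) (by decide)]
      exact (hg' ⟨d, hd⟩ ⟨s, hs⟩).symm)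
  set μ₁ := (Stmt.loop 6 0 (.loop 7 1 (.store (nextAddr 6 7) (stepE 6 7)))).run ρ μ with hμ₁
  have r2 := Stmt.run_fill (i := 6) (j := 7) (a := offerAddr 6 7) (v := .load (nextAddr 6 7))
    (μ := μ₁) (base := base m n + n) h0 h1 (by decide) g
    (fun d s μ' => by
      rw [eval_offerAddr (m := m) (n := n) (by simp [h0]) (by simp [h1]) μ' (by decide)]
      simp)
    (fun d hd s hs μ' hμ => by
      rw [Expr.eval, eval_nextAddr (m := m) (n := n) (by simp [h0]) (by simp [h1]) μ' (by decide),
        hμ _ (by omega), ← r1.2 d hd s hs]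
      simp)
  refine ⟨fun x hx => (r2.1 x (Or.inl hx)).trans (r1.1 x (by omega)), fun d s => ?_⟩
  exact (r2.2 d d.isLt s s.isLt).trans (hg' d s)

/-- Loops are bounded only by `m` or `n`; nesting one of each gives the `m * n` iterations that
reach the fixed point. -/
theorem run_offersS (hI : HasInput M c μ) (hY : HasSurvivors Y m μ) (h0 : ρ 0 = m)
    (h1 : ρ 1 = n) :
    (∀ x < base m n + n, offersS.run ρ μ x = μ x) ∧
      HasOffers (M.offersWith c Y) (offersS.run ρ μ) := by
  obtain ⟨c1, c2⟩ := run_clearS (μ := μ) h0 h1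
  have := Stmt.run_loop_induct (i := 9) (b := 0) (s := .loop 10 1 stepS) (ρ := ρ)
    (μ := clearS.run ρ μ) (fun k μ' => (∀ x < base m n + n, μ' x = μ x) ∧
      HasOffers ((M.offerStep c Y)^[k * n] ⊥) μ') ⟨c1, by simpa using c2⟩ (by
    rintro k hk μ₁ hμ₁
    have h0' : Function.update ρ 9 k 0 = m := by simp [h0]
    have h1' : Function.update ρ 9 k 1 = n := by simp [h1]
    have := Stmt.run_loop_induct (i := 10) (b := 1) (s := stepS) (ρ := Function.update ρ 9 k)
      (μ := μ₁) (fun l μ' => (∀ x < base m n + n, μ' x = μ x) ∧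
        HasOffers ((M.offerStep c Y)^[k * n + l] ⊥) μ') hμ₁ (by
      rintro l hl μ₂ ⟨hout, hO⟩
      obtain ⟨s1, s2⟩ := run_stepS (hI.congr fun x hx => hout x (by omega))
        (hY.congr fun t => hout _ (by have := t.isLt; omega)) hO
        (ρ := Function.update (Function.update ρ 9 k) 10 l) (by simp [h0]) (by simp [h1])
      refine ⟨fun x hx => (s1 x hx).trans (hout x hx), ?_⟩
      rwa [← add_assoc, Function.iterate_succ_apply'])
    rw [h1'] at this
    rwa [Nat.succ_mul])
  rw [h0] at this
  exact this

/-- The candidate is erased tentatively and restored if the recomputed number of chosen students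
falls below the capacity. -/
theorem run_deleteS (hI : HasInput M c μ) (h0 : ρ 0 = m) (h1 : ρ 1 = n) {j : ℕ} (hj : j < n)
    (h8 : ρ 8 = j) (hY : HasSurvivors (M.survivors c j) m μ) :
    HasInput M c (deleteS.run ρ μ) ∧
      HasSurvivors (M.survivors c (j + 1)) m (deleteS.run ρ μ) := by
  obtain ⟨s, hs⟩ := M.exists_student_at c hj
  set Y := M.survivors c j with hYdef
  have hsY : s ∈ Y := M.mem_survivors_of_lt c (by omega)
  set μ₁ := Function.update μ (base m n + s) 0 with hμ₁
  have e1 : (Stmt.store (survivorAddr candidateE) (.lit 0)).run ρ μ = μ₁ := by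
    rw [Stmt.run, eval_survivorAddr h0 h1, eval_candidateE hI h0 h1 h8 hs]
    rfl
  have hI₁ : HasInput M c μ₁ := hI.congr fun x hx => Function.update_of_ne (by omega) _ _
  have hY₁ : HasSurvivors (Y.erase s) m μ₁ := by simpa using hY.update s False
  obtain ⟨o1, hO⟩ := run_offersS hI₁ hY₁ h0 h1
  set μ₂ := offersS.run ρ μ₁ with hμ₂
  have hI₂ : HasInput M c μ₂ := hI₁.congr fun x hx => o1 x (by omega)
  have hY₂ : HasSurvivors (Y.erase s) m μ₂ :=
    hY₁.congr fun t => o1 _ (by have := t.isLt; omega)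
  have e2 : deleteS.run ρ μ = Function.update μ₂ (base m n + s)
      (if (M.chosen c (Y.erase s)).card < M.q c then 1 else 0) := by
    rw [deleteS, Stmt.run, e1, Stmt.run, ← hμ₂, Stmt.run, eval_survivorAddr h0 h1,
      eval_candidateE hI₂ h0 h1 h8 hs]
    simp only [Expr.eval, hI₂.college, hI₂.capacity,
      eval_chosenE hI₂ hY₂ hO h0 h1 (M.offersWith_self c _), chosen, ne_eq,
      Nat.sub_eq_zero_iff_le, not_le]
    congr
  rw [e2]
  refine ⟨hI₂.congr fun x hx => Function.update_of_ne (by omega) _ _, ?_⟩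
  have := hY₂.update s ((M.chosen c (Y.erase s)).card < M.q c)
  rwa [Finset.insert_erase hsY, Finset.erase_idem, ← deleteStep, hYdef,
    ← M.survivors_succ c hs] at this

theorem le_base (c : Fin m) : n ≤ base m n := by
  have := Nat.le_mul_of_pos_left n c.pos
  unfold base
  omega

/-- The output overwrites part of the input. This is harmless, since only the survivor bits are
still read and they begin at `base m n`, which is at least `n`. -/
theorem run_reportS (c : Fin m) (hY : HasSurvivors Y m μ) (h0 : ρ 0 = m) (h1 : ρ 1 = n) :
    ∀ k : Fin n, reportS.run ρ μ k = (report Y k : Fin n) := by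
  have hbase := le_base (n := n) c
  have := Stmt.run_loop_induct (i := 6) (b := 1) (s := .store (.reg 6) (reportE 6)) (ρ := ρ)
    (μ := μ) (fun k μ' => (∀ x, n ≤ x → μ' x = μ x) ∧
      ∀ i : Fin n, (i : ℕ) < k → μ' i = (report Y i : Fin n)) ⟨fun _ _ => rfl, by simp⟩ (by
    rintro k hk μ' ⟨hout, hin⟩
    rw [h1] at hk
    rw [Stmt.run, Expr.eval, Function.update_self,
      eval_reportE (k' := ⟨k, hk⟩) (hY.congr fun s => hout _ (by omega)) (by simp [h0])
        (by simp [h1]) (by simp) (by decide)]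
    refine ⟨fun x hx => ?_, fun i hi => ?_⟩
    · rw [Function.update_of_ne (by omega), hout x hx]
    · by_cases hik : (i : ℕ) = k
      · subst hik; simp
      · rw [Function.update_of_ne hik, hin i (by omega)])
  rw [h1] at this
  exact fun k => this.2 k k.isLt

theorem run_mainS (hI : HasInput M c μ) (h0 : ρ 0 = m) (h1 : ρ 1 = n) (k : Fin n) :
    mainS.run ρ μ k = (report (M.survivors c n) k : Fin n) := by
  obtain ⟨i1, i2⟩ := run_initS (μ := μ) h0 h1
  have := Stmt.run_loop_induct (i := 8) (b := 1) (s := deleteS) (ρ := ρ) (μ := initS.run ρ μ)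
    (fun j μ' => HasInput M c μ' ∧ HasSurvivors (M.survivors c j) m μ')
    ⟨hI.congr i1, i2⟩ (fun j hj μ' h =>
      run_deleteS h.1 (by simp [h0]) (by simp [h1]) (h1 ▸ hj) (by simp) h.2)
  rw [h1] at this
  exact run_reportS c this.2 h0 h1 k

end Run

/-! ### The input -/

theorem getD_flatten {k b : ℕ} (L : List (List ℕ)) (hL : ∀ l ∈ L, l.length = b) (i : ℕ)
    (hk : k < b) : L.flatten.getD (b * i + k) 0 = (L.getD i []).getD k 0 := by
  induction L generalizing i with
  | nil => simp
  | cons l L ih =>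
    have hl : l.length = b := hL l (by simp)
    rw [List.flatten_cons]
    cases i with
    | zero => rw [List.getD_append _ _ _ _ (by omega)]; simp
    | succ i =>
      rw [List.getD_append_right _ _ _ _ (by rw [hl, Nat.mul_succ]; omega),
        List.getD_cons_succ, ← ih (fun l' h => hL l' (by simp [h])), hl]
      congr 1
      rw [Nat.mul_succ]
      omega

theorem getD_ofFn {α : Type*} {k : ℕ} (f : Fin k → α) (i : Fin k) (a : α) :
    (List.ofFn f).getD i a = f i := by
  simp [List.getD]

theorem hasInput_inputState (M : Market m n) (c : Fin m) : HasInput M c (M.inputState c).mem := by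
  have hl1 : (List.ofFn fun j => List.ofFn fun k =>
      ((M.collegeList j k : Fin n) : ℕ)).flatten.length = m * n := by
    simp [List.length_flatten, Function.comp_def]
  constructor
  · simp [inputState, encode]
  · intro d
    have := d.isLt
    simp only [inputState, encode]
    rw [List.append_assoc, List.append_assoc, List.getD_append_right _ _ _ _ (by simp),
      List.getD_append _ _ _ _ (by simp)]
    simp
  · intro d k
    have := mul_add_lt d k
    simp only [inputState, encode]
    rw [List.getD_append _ _ _ _ (by simp only [List.length_append, hl1]; simp; omega),
      List.getD_append_right _ _ _ _ (by simp; omega)]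
    have e : 3 + m + n * (d : ℕ) + k - ([m, n, (c : ℕ)] ++ List.ofFn M.q).length = n * d + k := by
      simp; omega
    rw [e, getD_flatten _ (by simp) _ k.isLt, getD_ofFn, getD_ofFn]
  · intro s k
    simp only [inputState, encode]
    have e' : ([m, n, (c : ℕ)] ++ List.ofFn M.q ++ (List.ofFn fun j => List.ofFn fun k =>
      ((M.collegeList j k : Fin n) : ℕ)).flatten).length = 3 + m + m * n := by
      rw [List.length_append, hl1]; simp; omega
    rw [List.getD_append_right _ _ _ _ (by rw [e']; omega), e']
    have e : 3 + m + m * n + m * (s : ℕ) + k - (3 + m + m * n) = m * s + k := by omega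
    rw [e, getD_flatten _ (by simp) _ k.isLt, getD_ofFn, getD_ofFn]

/-- The machine program: load the numbers of colleges and students, then run `mainS`. -/
def program : Cmd :=
  .seq (.const 0 0) (.seq (.load 0 0) (.seq (.const 1 1) (.seq (.load 1 1) (mainS.compile 11))))

theorem exec_program (M : Market m n) (c : Fin m) :
    ∃ σ t, Exec program (M.inputState c) σ t ∧ t ≤ mainS.cost (m + n) + 4 ∧
      σ.HoldsList (report (M.survivors c n)) := by
  set σ₀ : State := (((((M.inputState c).setReg 0 0).setReg 0 m).setReg 1 1).setReg 1 n) with hσ₀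
  have h0 : σ₀.reg 0 = m := by simp [hσ₀, State.setReg]
  have h1 : σ₀.reg 1 = n := by simp [hσ₀, State.setReg]
  obtain ⟨σ, t, E, ht, hm, -⟩ := mainS.exec_compile (B := m + n) (by decide) mainS_wf le_rfl σ₀
    (by omega) (by omega)
  have E1 : Exec (.load 0 0) ((M.inputState c).setReg 0 0)
      (((M.inputState c).setReg 0 0).setReg 0 m) 1 :=
    .load ((M.inputState c).setReg 0 0) 0 0
  have E2 : Exec (.load 1 1) ((((M.inputState c).setReg 0 0).setReg 0 m).setReg 1 1) σ₀ 1 :=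
    .load ((((M.inputState c).setReg 0 0).setReg 0 m).setReg 1 1) 1 1
  refine ⟨σ, _, .seq (.const ..) (.seq E1 (.seq (.const ..) (.seq E2 E))), by omega, fun k => ?_⟩
  rw [hm]
  exact run_mainS (hasInput_inputState M c) h0 h1 k

end ManipulationProgram

theorem mainTheorem6 :
    ∃ (prog : RAM.Cmd) (A d : ℕ),
      ∀ (m n : ℕ) (M : Market m n) (c : Fin m),
        ∃ (σ : RAM.State) (t : ℕ) (p : Equiv.Perm (Fin n)),
          RAM.Exec prog (M.inputState c) σ t ∧
          t ≤ 2 ^ (M.q c - 1) * (A * (m + n) ^ d) ∧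
          σ.HoldsList p ∧
          M.IsOptimalManipulation c p := by
  obtain ⟨A, d, hA⟩ := ManipulationProgram.mainS.polyBounded_cost.add (.const 4)
  refine ⟨ManipulationProgram.program, A * 2 ^ d, d, fun m n M c => ?_⟩
  obtain ⟨σ, t, E, ht, hσ⟩ := ManipulationProgram.exec_program M c
  refine ⟨σ, t, _, E, ?_, hσ, M.isOptimalManipulation_of_topStudents c
    (ManipulationProgram.topStudents_report _)⟩
  -- The existence of `c` gives `1 ≤ m + n`, so `m + n + 1` is at most `2 * (m + n)`; this is the
  -- origin of the factor `2 ^ d`. The exponential factor is only bounded below by one.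
  have hpos := c.pos
  calc t ≤ A * (m + n + 1) ^ d := ht.trans (hA _)
    _ ≤ A * (2 * (m + n)) ^ d := Nat.mul_le_mul_left _ (Nat.pow_le_pow_left (by omega) d)
    _ = A * 2 ^ d * (m + n) ^ d := by rw [mul_pow, mul_assoc]
    _ ≤ 2 ^ (M.q c - 1) * (A * 2 ^ d * (m + n) ^ d) :=
      Nat.le_mul_of_pos_left _ (Nat.pow_pos (by decide))
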